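/- Work in the real-RAM model with the floor function: integer and real registers and arrays, where each of the following takes one step: an integer addition or subtraction, a real addition, subtraction, multiplication or division, a copy, loading an integer constant, the conversion of an integer to a real, $x\mapsto\lfloor x\rfloor$, a comparison, and an access to an array cell. For $\theta\in[0,\pi)$, a slab of orientation $\theta$ is the closed region between two parallel lines that make a counterclockwise angle $\theta$ with the $x$-axis; its width is the distance between these two lines, and width $0$ (a single line) is allowed. For a finite set $S$ of points in the plane and $\theta_1,\theta_2\in[0,\pi)$ (possibly equal), let $w^*$ be the minimum of $\max\{w(\sigma_1),w(\sigma_2)\}$ over all pairs of slabs $(\sigma_1,\sigma_2)$ such that $\sigma_i$ has orientation $\theta_i$ and width $w(\sigma_i)$, and $S\subseteq\sigma_1\cup\sigma_2$ (this minimum exists). There are a single algorithm (one finite program with integer constants only) and an absolute constant $C$ such that the following holds. Given $n\ge 1$ points in the plane by their coordinates, forming the set $S$, two orientations $\theta_1,\theta_2\in[0,\pi)$ by their unit direction vectors $(\cos\theta_i,\sin\theta_i)$, and $\varepsilon>0$, the algorithm halts after at most $C\,(n+1/\varepsilon)$ steps and returns a slab $\sigma_1$ of orientation $\theta_1$ and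 a slab $\sigma_2$ of orientation $\theta_2$ such that $S\subseteq\sigma_1\cup\sigma_2$ and $\max\{w(\sigma_1),w(\sigma_2)\}\le(1+\varepsilon)\,w^*$. -/

import Mathlib

/-! ## Slabs in the plane -/

/-- The Euclidean plane. -/
abbrev Plane : Type := EuclideanSpace ℝ (Fin 2)

/-- The unit normal `(-sin θ, cos θ)` of the lines of orientation `θ`, that is, of the lines with
direction `(cos θ, sin θ)`. -/
noncomputable def unitNormal (θ : ℝ) : Plane := !₂[-Real.sin θ, Real.cos θ]

/-- The line of orientation `θ` at signed distance `c` from the origin. -/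
def orientedLine (θ c : ℝ) : Set Plane := {q | inner ℝ (unitNormal θ) q = c}

/-- A slab: the closed region between the parallel lines `orientedLine θ lo` and
`orientedLine θ hi`, both of orientation `θ ∈ [0, π)`. If `lo = hi`, it degenerates to a line. -/
structure Slab where
  orientation : ℝ
  lo : ℝ
  hi : ℝ
  orientation_mem : orientation ∈ Set.Ico 0 Real.pi
  lo_le_hi : lo ≤ hi

namespace Slab

/-- The points of the slab. -/
def carrier (σ : Slab) : Set Plane :=
  {q | σ.lo ≤ inner ℝ (unitNormal σ.orientation) q ∧ inner ℝ (unitNormal σ.orientation) q ≤ σ.hi}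

/-- The distance between the two bounding lines (`unitNormal` has norm one). -/
def width (σ : Slab) : ℝ := σ.hi - σ.lo

end Slab

/-- `(σ₁, σ₂)` is a pair of slabs of orientations `θ₁` and `θ₂` whose union covers `S`. -/
def IsCoveringPair (θ₁ θ₂ : ℝ) (S : Set Plane) (σ₁ σ₂ : Slab) : Prop :=
  σ₁.orientation = θ₁ ∧ σ₂.orientation = θ₂ ∧ S ⊆ σ₁.carrier ∪ σ₂.carrier

/-- `w` is the maximum width of an optimal pair of slabs of orientations `θ₁` and `θ₂`
covering `S`. -/
def IsOptimalWidth (θ₁ θ₂ : ℝ) (S : Set Plane) (w : ℝ) : Prop :=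
  IsLeast {v | ∃ σ₁ σ₂ : Slab, IsCoveringPair θ₁ θ₂ S σ₁ σ₂ ∧ v = max σ₁.width σ₂.width} w

/-! ## The real RAM with the floor function

A machine has finitely many (those named in its program) integer registers, real registers,
integer arrays and real arrays. Arrays are unbounded and are addressed by integer registers.
Every instruction and every test costs one step. The only constants in programs are integers. -/

namespace RealRAM

/-- A memory state. -/
structure State where
  ireg : ℕ → ℤ
  rreg : ℕ → ℝ
  iarr : ℕ → ℤ → ℤ
  rarr : ℕ → ℤ → ℝ

/-- Elementary instructions. `d` is always the destination register, `a` and `b` are operand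
registers, `A` is the name of an array, and `k` is the integer register that holds the address. -/
inductive Instr where
  | iconst (d : ℕ) (z : ℤ)
  | icopy (d a : ℕ)
  | iadd (d a b : ℕ)
  | isub (d a b : ℕ)
  | iload (d A k : ℕ)
  | istore (A k a : ℕ)
  | rcopy (d a : ℕ)
  | radd (d a b : ℕ)
  | rsub (d a b : ℕ)
  | rmul (d a b : ℕ)
  | rdiv (d a b : ℕ)
  | rload (d A k : ℕ)
  | rstore (A k a : ℕ)
  | ofInt (d a : ℕ)
  | floor (d a : ℕ)

/-- Assignment to an integer register. -/
def State.setI (s : State) (d : ℕ) (z : ℤ) : State :=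
  { s with ireg := Function.update s.ireg d z }

/-- Assignment to a real register. -/
def State.setR (s : State) (d : ℕ) (x : ℝ) : State :=
  { s with rreg := Function.update s.rreg d x }

/-- Assignment to cell `k` of the integer array `A`. -/
def State.setIArr (s : State) (A : ℕ) (k : ℤ) (z : ℤ) : State :=
  { s with iarr := Function.update s.iarr A (Function.update (s.iarr A) k z) }

/-- Assignment to cell `k` of the real array `A`. -/
def State.setRArr (s : State) (A : ℕ) (k : ℤ) (x : ℝ) : State :=
  { s with rarr := Function.update s.rarr A (Function.update (s.rarr A) k x) }

/-- The effect of an instruction. Division by zero yields zero. -/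
noncomputable def Instr.exec : Instr → State → State
  | .iconst d z, s => s.setI d z
  | .icopy d a, s => s.setI d (s.ireg a)
  | .iadd d a b, s => s.setI d (s.ireg a + s.ireg b)
  | .isub d a b, s => s.setI d (s.ireg a - s.ireg b)
  | .iload d A k, s => s.setI d (s.iarr A (s.ireg k))
  | .istore A k a, s => s.setIArr A (s.ireg k) (s.ireg a)
  | .rcopy d a, s => s.setR d (s.rreg a)
  | .radd d a b, s => s.setR d (s.rreg a + s.rreg b)
  | .rsub d a b, s => s.setR d (s.rreg a - s.rreg b)
  | .rmul d a b, s => s.setR d (s.rreg a * s.rreg b)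
  | .rdiv d a b, s => s.setR d (s.rreg a / s.rreg b)
  | .rload d A k, s => s.setR d (s.rarr A (s.ireg k))
  | .rstore A k a, s => s.setRArr A (s.ireg k) (s.rreg a)
  | .ofInt d a, s => s.setR d (s.ireg a : ℝ)
  | .floor d a, s => s.setI d ⌊s.rreg a⌋

/-- Tests: comparisons of two integer registers or of two real registers. -/
inductive Test where
  | ilt (a b : ℕ)
  | ile (a b : ℕ)
  | rlt (a b : ℕ)
  | rle (a b : ℕ)

/-- When a test succeeds. -/
def Test.Holds : Test → State → Prop
  | .ilt a b, s => s.ireg a < s.ireg b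
  | .ile a b, s => s.ireg a ≤ s.ireg b
  | .rlt a b, s => s.rreg a < s.rreg b
  | .rle a b, s => s.rreg a ≤ s.rreg b

/-- Programs. -/
inductive Prog where
  | skip
  | instr (i : Instr)
  | seq (P Q : Prog)
  | cond (c : Test) (P Q : Prog)
  | loop (c : Test) (P : Prog)

/-- `Runs P s s' t`: started in state `s`, the program `P` halts in state `s'` after exactly `t`
steps. Here `cond c P Q` is `if c then P else Q` and `loop c P` is `while c do P`. -/
inductive Runs : Prog → State → State → ℕ → Prop where
  | skip (s : State) : Runs .skip s s 0
  | instr (i : Instr) (s : State) : Runs (.instr i) s (i.exec s) 1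
  | seq {P Q : Prog} {s s₁ s₂ : State} {t₁ t₂ : ℕ} :
      Runs P s s₁ t₁ → Runs Q s₁ s₂ t₂ → Runs (.seq P Q) s s₂ (t₁ + t₂)
  | cond_true {c : Test} {P Q : Prog} {s s' : State} {t : ℕ} :
      c.Holds s → Runs P s s' t → Runs (.cond c P Q) s s' (1 + t)
  | cond_false {c : Test} {P Q : Prog} {s s' : State} {t : ℕ} :
      ¬ c.Holds s → Runs Q s s' t → Runs (.cond c P Q) s s' (1 + t)
  | loop_true {c : Test} {P : Prog} {s s₁ s₂ : State} {t₁ t₂ : ℕ} :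
      c.Holds s → Runs P s s₁ t₁ → Runs (.loop c P) s₁ s₂ t₂ →
        Runs (.loop c P) s s₂ (1 + t₁ + t₂)
  | loop_false {c : Test} {P : Prog} {s : State} :
      ¬ c.Holds s → Runs (.loop c P) s s 1

/-- Execution is deterministic, so that `Runs` determines the result and the running time. -/
theorem Runs.deterministic {P : Prog} {s s₁ : State} {t₁ : ℕ} (h₁ : Runs P s s₁ t₁) :
    ∀ {s₂ : State} {t₂ : ℕ}, Runs P s s₂ t₂ → s₁ = s₂ ∧ t₁ = t₂ := by
  induction h₁ with
  | skip s => intro s₂ t₂ h; cases h; exact ⟨rfl, rfl⟩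
  | instr i s => intro s₂ t₂ h; cases h; exact ⟨rfl, rfl⟩
  | seq _ _ ihP ihQ =>
    intro s₂ t₂ h
    cases h with
    | seq hP hQ =>
      obtain ⟨rfl, rfl⟩ := ihP hP
      obtain ⟨rfl, rfl⟩ := ihQ hQ
      exact ⟨rfl, rfl⟩
  | cond_true hc _ ih =>
    intro s₂ t₂ h
    cases h with
    | cond_true _ hP => obtain ⟨rfl, rfl⟩ := ih hP; exact ⟨rfl, rfl⟩
    | cond_false hn _ => exact absurd hc hn
  | cond_false hc _ ih =>
    intro s₂ t₂ h
    cases h with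
    | cond_true hp _ => exact absurd hp hc
    | cond_false _ hQ => obtain ⟨rfl, rfl⟩ := ih hQ; exact ⟨rfl, rfl⟩
  | loop_true hc _ _ ihP ihL =>
    intro s₂ t₂ h
    cases h with
    | loop_true _ hP hL =>
      obtain ⟨rfl, rfl⟩ := ihP hP
      obtain ⟨rfl, rfl⟩ := ihL hL
      exact ⟨rfl, rfl⟩
    | loop_false hn => exact absurd hc hn
  | loop_false hc =>
    intro s₂ t₂ h
    cases h with
    | loop_true hp _ _ => exact absurd hp hc
    | loop_false _ => exact ⟨rfl, rfl⟩

/-- The initial state on the points `p 0, …, p (n - 1)`, the orientations `θ₁`, `θ₂` and the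
accuracy `ε`: integer register 0 holds `n`, real register 0 holds `ε`, real registers 1 to 4 hold
the unit direction vectors `(cos θ₁, sin θ₁)` and `(cos θ₂, sin θ₂)`, cell `k` of real array 0
(resp. 1) holds the `x`-coordinate (resp. `y`-coordinate) of `p k`, and everything else is zero. -/
noncomputable def input {n : ℕ} (p : Fin n → Plane) (θ₁ θ₂ ε : ℝ) : State where
  ireg := fun r => if r = 0 then (n : ℤ) else 0
  rreg := fun r => match r with
    | 0 => ε
    | 1 => Real.cos θ₁
    | 2 => Real.sin θ₁
    | 3 => Real.cos θ₂
    | 4 => Real.sin θ₂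
    | _ => 0
  iarr := fun _ _ => 0
  rarr := fun A k =>
    if h : 0 ≤ k ∧ k.toNat < n then
      match A with
      | 0 => p ⟨k.toNat, h.2⟩ 0
      | 1 => p ⟨k.toNat, h.2⟩ 1
      | _ => 0
    else 0

/-- The state `s` reports the pair `(σ₁, σ₂)` of slabs: real registers 0 to 3 hold the offsets of
the bounding lines of `σ₁` and of `σ₂`. (The orientations are those given in the input.) -/
def Reports (s : State) (σ₁ σ₂ : Slab) : Prop :=
  s.rreg 0 = σ₁.lo ∧ s.rreg 1 = σ₁.hi ∧ s.rreg 2 = σ₂.lo ∧ s.rreg 3 = σ₂.hi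

end RealRAM

/-!
Write `A k` and `B k` for the signed distances of the `k`-th point along the normals of the two
orientations. Two slabs are two intervals `I` and `J`, and they cover the points if `A k ∈ I` or
`B k ∈ J` for all `k`. The task is to minimise `w = max (|I|, |J|)`; nothing else about the plane
matters.

*Anchors.* Suppose two indices `q`, `r` are known such that `A q ∈ I` and `B r ∈ J` in some optimal
solution. Then every point satisfies `|A k - A q| ≤ w` or `|B k - B r| ≤ w`, so
`W = max_k min(|A k - A q|, |B k - B r|)` is at most `w`, while the intervals of radius `W` around
`A q` and `B r` form a covering of width `2 W`. Such `q` and `r` are easy to find: a slab `I` that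
misses a point misses a point with extreme `A`, which then lies in the other slab, and vice versa.
Hence it suffices to try the two extreme points of `B` as `q` and the two extreme points of `A` as
`r` (`Feasible.le_of_anchoredBound`).

*Grid.* If `w ≤ 2 W`, then `I ⊆ [A q - 2 W, A q + 2 W]`. This interval is cut into
`N = ⌊8 / ε⌋ + 1` buckets of length `δ = 4 W / N`. Rounding `I` outwards to the grid adds at most
`2 δ ≤ ε W ≤ ε w` (`Feasible.exists_window`). One pass over the points, with the floor function,
gives the range of `B` in each bucket, and points outside the grid go to an extra bucket. All these
ranges are started with `B r`, so that none is empty.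

*Walk.* For a window of buckets `i, …, j - 1` the cost is the maximum of its length, which increases
with `j` and decreases with `i`, and the length of the range of `B` outside the window, which
behaves in the opposite way. Therefore, starting at `(0, 0)`, it suffices to increase `j` when the
range outside is at least as long as the window, and `i` otherwise: all windows skipped by such a
step cost at least as much as the current one (`Measured.cost_le`). The walk takes `O(N)` steps
(`achieves_walk`), and everything else takes `O(n + N)`.

The program is verified with a total correctness predicate `Achieves` that includes the running
time; programs without loops are evaluated symbolically, and registers in which a program never
writes are handled by `Runs.frame`.
-/

/-! ### Reasoning about programs -/

namespace RealRAM

namespace State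

variable (s : State) (d r A : ℕ) (k z : ℤ) (x : ℝ)

@[simp] lemma ireg_setI : (s.setI d z).ireg r = if r = d then z else s.ireg r := by
  simp [setI, Function.update_apply]
@[simp] lemma rreg_setI : (s.setI d z).rreg = s.rreg := rfl
@[simp] lemma rarr_setI : (s.setI d z).rarr = s.rarr := rfl
@[simp] lemma ireg_setR : (s.setR d x).ireg = s.ireg := rfl
@[simp] lemma rreg_setR : (s.setR d x).rreg r = if r = d then x else s.rreg r := by
  simp [setR, Function.update_apply]
@[simp] lemma rarr_setR : (s.setR d x).rarr = s.rarr := rfl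
@[simp] lemma ireg_setIArr : (s.setIArr A k z).ireg = s.ireg := rfl
@[simp] lemma rreg_setIArr : (s.setIArr A k z).rreg = s.rreg := rfl
@[simp] lemma rarr_setIArr : (s.setIArr A k z).rarr = s.rarr := rfl
@[simp] lemma ireg_setRArr : (s.setRArr A k x).ireg = s.ireg := rfl
@[simp] lemma rreg_setRArr : (s.setRArr A k x).rreg = s.rreg := rfl
@[simp] lemma rarr_setRArr :
    (s.setRArr A k x).rarr r = if r = A then Function.update (s.rarr A) k x else s.rarr r := by
  simp [setRArr, Function.update_apply]

end State

/-- `Achieves P s T Q`: started in state `s`, the program `P` halts after at most `T` steps in a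
state satisfying `Q`. -/
def Achieves (P : Prog) (s : State) (T : ℕ) (Q : State → Prop) : Prop :=
  ∃ (s' : State) (t : ℕ), Runs P s s' t ∧ t ≤ T ∧ Q s'

namespace Achieves

variable {P P' : Prog} {s : State} {T T' : ℕ} {Q Q' : State → Prop}

lemma mono (h : Achieves P s T Q) (hT : T ≤ T') (hQ : ∀ s', Q s' → Q' s') :
    Achieves P s T' Q' := by
  obtain ⟨s', t, h₁, h₂, h₃⟩ := h
  exact ⟨s', t, h₁, h₂.trans hT, hQ s' h₃⟩

lemma skip (h : Q s) : Achieves .skip s 0 Q := ⟨s, 0, .skip s, le_rfl, h⟩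

lemma instr {i : Instr} (h : Q (i.exec s)) : Achieves (.instr i) s 1 Q :=
  ⟨_, 1, .instr i s, le_rfl, h⟩

lemma seq (h : Achieves P s T fun s' => Achieves P' s' T' Q) :
    Achieves (.seq P P') s (T + T') Q := by
  obtain ⟨s₁, t₁, r₁, h₁, s₂, t₂, r₂, h₂, h⟩ := h
  exact ⟨s₂, t₁ + t₂, .seq r₁ r₂, by omega, h⟩

lemma cond {c : Test} (h₁ : c.Holds s → Achieves P s T Q)
    (h₂ : ¬ c.Holds s → Achieves P' s T Q) : Achieves (.cond c P P') s (1 + T) Q := by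
  by_cases hc : c.Holds s
  · obtain ⟨s', t, r, ht, h⟩ := h₁ hc
    exact ⟨s', 1 + t, .cond_true hc r, by omega, h⟩
  · obtain ⟨s', t, r, ht, h⟩ := h₂ hc
    exact ⟨s', 1 + t, .cond_false hc r, by omega, h⟩

end Achieves

/-- The sequential composition of a list of programs. -/
def seqs : List Prog → Prog
  | [] => .skip
  | P :: l => .seq P (seqs l)

/-- A program without loops, read as a function on states. (Loops are read as `skip`.) -/
noncomputable def Prog.eval : Prog → State → State
  | .skip, s => s
  | .instr i, s => i.exec s
  | .seq P Q, s => Q.eval (P.eval s)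
  | .cond c P Q, s => open Classical in if c.Holds s then P.eval s else Q.eval s
  | .loop _ _, s => s

/-- The program contains no loop. -/
def Prog.loopFree : Prog → Bool
  | .skip => true
  | .instr _ => true
  | .seq P Q => P.loopFree && Q.loopFree
  | .cond _ P Q => P.loopFree && Q.loopFree
  | .loop _ _ => false

/-- A bound for the number of steps of a program without loops. -/
def Prog.cost : Prog → ℕ
  | .skip => 0
  | .instr _ => 1
  | .seq P Q => P.cost + Q.cost
  | .cond _ P Q => 1 + (P.cost + Q.cost)
  | .loop _ _ => 0

/-- A program without loops is analysed by evaluating it. -/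
lemma Achieves.of_eval {P : Prog} (hP : P.loopFree = true) {T : ℕ} (hT : P.cost ≤ T) {s : State}
    {Q : State → Prop} (h : Q (P.eval s)) : Achieves P s T Q := by
  suffices H : ∀ s, Achieves P s P.cost (· = P.eval s) from
    (H s).mono hT fun s' hs' => by rwa [hs']
  clear h hT
  induction P with
  | skip => exact fun s => .skip rfl
  | instr i => exact fun s => .instr rfl
  | seq P Q ihP ihQ =>
    intro s
    rw [Prog.loopFree, Bool.and_eq_true] at hP
    refine .seq ((ihP hP.1 s).mono le_rfl ?_)
    rintro _ rfl
    exact ihQ hP.2 _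
  | cond c P Q ihP ihQ =>
    intro s
    rw [Prog.loopFree, Bool.and_eq_true] at hP
    refine .cond (fun hc => (ihP hP.1 s).mono (by omega) ?_)
      (fun hc => (ihQ hP.2 s).mono (by omega) ?_)
    · rintro _ rfl; simp [Prog.eval, hc]
    · rintro _ rfl; simp [Prog.eval, hc]
  | loop c P => simp [Prog.loopFree] at hP

/-- `d := min a b`. -/
def rmin (d a b : ℕ) : Prog := .cond (.rle a b) (.instr (.rcopy d a)) (.instr (.rcopy d b))

/-- `d := max a b`. -/
def rmax (d a b : ℕ) : Prog := .cond (.rle a b) (.instr (.rcopy d b)) (.instr (.rcopy d a))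

@[simp] lemma eval_rmin (d a b : ℕ) (s : State) :
    (rmin d a b).eval s = s.setR d (min (s.rreg a) (s.rreg b)) := by
  by_cases h : s.rreg a ≤ s.rreg b
  · simp [rmin, Prog.eval, Test.Holds, Instr.exec, h]
  · simp [rmin, Prog.eval, Test.Holds, Instr.exec, h, le_of_not_ge h]

@[simp] lemma eval_rmax (d a b : ℕ) (s : State) :
    (rmax d a b).eval s = s.setR d (max (s.rreg a) (s.rreg b)) := by
  by_cases h : s.rreg a ≤ s.rreg b
  · simp [rmax, Prog.eval, Test.Holds, Instr.exec, h]
  · simp [rmax, Prog.eval, Test.Holds, Instr.exec, h, le_of_not_ge h]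

/-- The registers that an instruction may change: `writes false r` refers to integer
register `r`, `writes true r` to real register `r`. -/
def Instr.writes : Instr → Bool → ℕ → Bool
  | .iconst d _, b, r | .icopy d _, b, r | .iadd d _ _, b, r | .isub d _ _, b, r
  | .iload d _ _, b, r | .floor d _, b, r => !b && r == d
  | .rcopy d _, b, r | .radd d _ _, b, r | .rsub d _ _, b, r | .rmul d _ _, b, r
  | .rdiv d _ _, b, r | .rload d _ _, b, r | .ofInt d _, b, r => b && r == d
  | .istore _ _ _, _, _ | .rstore _ _ _, _, _ => false

/-- The instruction may change the real array `A`. -/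
def Instr.writesArr : Instr → ℕ → Bool
  | .rstore A _ _, B => B == A
  | _, _ => false

/-- The program may change register `r`, of integers if the Boolean is `false`, of reals
otherwise. -/
def Prog.writes : Prog → Bool → ℕ → Bool
  | .skip, _, _ => false
  | .instr i, b, r => i.writes b r
  | .seq P Q, b, r => P.writes b r || Q.writes b r
  | .cond _ P Q, b, r => P.writes b r || Q.writes b r
  | .loop _ P, b, r => P.writes b r

/-- The program may change the real array `A`. -/
def Prog.writesArr : Prog → ℕ → Bool
  | .skip, _ => false
  | .instr i, r => i.writesArr r
  | .seq P Q, r => P.writesArr r || Q.writesArr r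
  | .cond _ P Q, r => P.writesArr r || Q.writesArr r
  | .loop _ P, r => P.writesArr r

/-- The states `s` and `s'` agree on all registers and real arrays in which `P` never writes. -/
structure Frame (P : Prog) (s s' : State) : Prop where
  ireg : ∀ r, P.writes false r = false → s'.ireg r = s.ireg r
  rreg : ∀ r, P.writes true r = false → s'.rreg r = s.rreg r
  rarr : ∀ r, P.writesArr r = false → s'.rarr r = s.rarr r

lemma Frame.refl (P : Prog) (s : State) : Frame P s s :=
  ⟨fun _ _ => rfl, fun _ _ => rfl, fun _ _ => rfl⟩

lemma Frame.trans {P : Prog} {s₁ s₂ s₃ : State} (h : Frame P s₁ s₂) (h' : Frame P s₂ s₃) :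
    Frame P s₁ s₃ :=
  ⟨fun r hr => (h'.ireg r hr).trans (h.ireg r hr), fun r hr => (h'.rreg r hr).trans (h.rreg r hr),
    fun r hr => (h'.rarr r hr).trans (h.rarr r hr)⟩

lemma Instr.frame (i : Instr) (s : State) : Frame (.instr i) s (i.exec s) := by
  cases i <;> constructor <;> intro r hr <;>
    simp_all [Prog.writes, Instr.writes, Prog.writesArr, Instr.writesArr, Instr.exec]

lemma Runs.frame {P : Prog} {s s' : State} {t : ℕ} (h : Runs P s s' t) : Frame P s s' := by
  induction h with
  | skip s => exact .refl _ _
  | instr i s => exact i.frame s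
  | seq _ _ h₁ h₂ =>
    constructor <;> intro r hr <;>
      simp only [Prog.writes, Prog.writesArr, Bool.or_eq_false_iff] at hr
    · exact (h₂.ireg r hr.2).trans (h₁.ireg r hr.1)
    · exact (h₂.rreg r hr.2).trans (h₁.rreg r hr.1)
    · exact (h₂.rarr r hr.2).trans (h₁.rarr r hr.1)
  | cond_true _ _ h =>
    constructor <;> intro r hr <;>
      simp only [Prog.writes, Prog.writesArr, Bool.or_eq_false_iff] at hr
    · exact h.ireg r hr.1
    · exact h.rreg r hr.1
    · exact h.rarr r hr.1
  | cond_false _ _ h =>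
    constructor <;> intro r hr <;>
      simp only [Prog.writes, Prog.writesArr, Bool.or_eq_false_iff] at hr
    · exact h.ireg r hr.2
    · exact h.rreg r hr.2
    · exact h.rarr r hr.2
  | loop_true _ _ _ h₁ h₂ =>
    exact .trans ⟨h₁.ireg, h₁.rreg, h₁.rarr⟩ h₂
  | loop_false _ => exact .refl _ _

/-- The frame condition can be added to every postcondition, so specifications need to mention only
what a program changes. -/
lemma Achieves.frame {P : Prog} {s : State} {T : ℕ} {Q : State → Prop} (h : Achieves P s T Q) :
    Achieves P s T fun s' => Frame P s s' ∧ Q s' := by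
  obtain ⟨s', t, r, ht, hq⟩ := h
  exact ⟨s', t, r, ht, r.frame, hq⟩

/-- The rule for loops with an invariant `I` and a variant, the first argument of `I`. -/
lemma Achieves.loop {c : Test} {P : Prog} {s₀ : State} {T : ℕ} (I : ℕ → State → Prop)
    (step : ∀ m s, Frame P s₀ s → c.Holds s → I m s →
      Achieves P s T fun s' => ∃ m' < m, I m' s')
    (m : ℕ) (h : I m s₀) :
    Achieves (.loop c P) s₀ ((T + 1) * m + 1) fun s' =>
      Frame P s₀ s' ∧ ¬ c.Holds s' ∧ ∃ m', I m' s' := by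
  suffices H : ∀ m s, Frame P s₀ s → I m s → Achieves (.loop c P) s ((T + 1) * m + 1) fun s' =>
      Frame P s₀ s' ∧ ¬ c.Holds s' ∧ ∃ m', I m' s' from H m s₀ (.refl _ _) h
  clear h m
  intro m
  induction m using Nat.strong_induction_on with
  | _ m ih =>
    intro s hs h
    by_cases hc : c.Holds s
    · obtain ⟨s₁, t₁, r₁, ht₁, m', hm', h₁⟩ := step m s hs hc h
      obtain ⟨s₂, t₂, r₂, ht₂, h₂⟩ := ih m' hm' s₁ (hs.trans r₁.frame) h₁
      refine ⟨s₂, 1 + t₁ + t₂, .loop_true hc r₁ r₂, ?_, h₂⟩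
      have : (T + 1) * (m' + 1) ≤ (T + 1) * m := Nat.mul_le_mul_left _ hm'
      linarith
    · exact ⟨s, 1, .loop_false hc, by omega, hs, hc, m, h⟩

/-- The rule for `for` loops, in which integer register `c` runs from `a` to the value `b` of
integer register `e`. -/
lemma Achieves.for {c e : ℕ} {P : Prog} {s₀ : State} {T : ℕ} {a b : ℤ} (I : ℤ → State → Prop)
    (hab : a ≤ b) (he : P.writes false e = false) (hc₀ : s₀.ireg c = a) (he₀ : s₀.ireg e = b)
    (h₀ : I a s₀)
    (step : ∀ k s, Frame P s₀ s → a ≤ k → k < b → s.ireg c = k → I k s →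
      Achieves P s T fun s' => s'.ireg c = k + 1 ∧ I (k + 1) s') :
    Achieves (.loop (.ilt c e) P) s₀ ((T + 1) * (b - a).toNat + 1) fun s' =>
      Frame P s₀ s' ∧ I b s' := by
  refine (Achieves.loop (fun m s => ∃ k, s.ireg c = k ∧ a ≤ k ∧ k + m = b ∧ I k s) ?_
    (b - a).toNat ⟨a, hc₀, le_rfl, by omega, h₀⟩).mono le_rfl ?_
  · rintro m s hF hc ⟨k, hk, hak, hkm, hI⟩
    simp only [Test.Holds, hF.ireg e he, hk, he₀] at hc
    refine (step k s hF hak hc hk hI).mono le_rfl fun s' h' => ?_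
    exact ⟨m - 1, by omega, k + 1, h'.1, by omega, by omega, h'.2⟩
  · rintro s' ⟨hF, hc, m, k, hk, hak, hkm, hI⟩
    simp only [Test.Holds, hF.ireg e he, hk, he₀] at hc
    obtain rfl : k = b := by omega
    exact ⟨hF, hI⟩

end RealRAM

/-! ### Buckets and windows -/

/-- The slabs `x₀ ≤ a ≤ x₁` and `y₀ ≤ b ≤ y₁`, of width at most `w`, cover the points with
coordinates `(A k, B k)`, where `0 ≤ k < n`. -/
structure Feasible (n : ℤ) (A B : ℤ → ℝ) (x₀ x₁ y₀ y₁ w : ℝ) : Prop where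
  left_le : x₀ ≤ x₁
  right_le : y₀ ≤ y₁
  left_width : x₁ - x₀ ≤ w
  right_width : y₁ - y₀ ≤ w
  covers : ∀ k, 0 ≤ k → k < n → A k ∈ Set.Icc x₀ x₁ ∨ B k ∈ Set.Icc y₀ y₁

/-- `lo` and `hi` are the infimum and the supremum of `S`. -/
def HasRange (S : Set ℝ) (lo hi : ℝ) : Prop := IsGLB S lo ∧ IsLUB S hi

lemma HasRange.union {S S' : Set ℝ} {lo hi lo' hi' : ℝ} (h : HasRange S lo hi)
    (h' : HasRange S' lo' hi') : HasRange (S ∪ S') (min lo lo') (max hi hi') :=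
  ⟨h.1.union h'.1, h.2.union h'.2⟩

lemma HasRange.subset_Icc {S : Set ℝ} {lo hi : ℝ} (h : HasRange S lo hi) : S ⊆ Set.Icc lo hi :=
  fun _ hx => ⟨h.1.1 hx, h.2.1 hx⟩

lemma HasRange.width_le {S : Set ℝ} {lo hi y₀ y₁ : ℝ} (h : HasRange S lo hi)
    (hS : S ⊆ Set.Icc y₀ y₁) : hi - lo ≤ y₁ - y₀ :=
  sub_le_sub (h.2.2 fun _ hx => (hS hx).2) (h.1.2 fun _ hx => (hS hx).1)

/-- The values `B k` at the indices `0 ≤ k < n` that satisfy `p`, together with the value `b`,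
which makes this set nonempty. -/
def valuesAt (n : ℤ) (B : ℤ → ℝ) (b : ℝ) (p : ℤ → Prop) : Set ℝ :=
  insert b (B '' {k | 0 ≤ k ∧ k < n ∧ p k})

lemma mem_valuesAt {n : ℤ} {B : ℤ → ℝ} {b : ℝ} {p : ℤ → Prop} (y : ℝ) :
    y ∈ valuesAt n B b p ↔ y = b ∨ ∃ k, 0 ≤ k ∧ k < n ∧ p k ∧ B k = y := by
  simp [valuesAt, and_assoc]

lemma valuesAt_mono {n : ℤ} {B : ℤ → ℝ} {b : ℝ} {p q : ℤ → Prop} (h : ∀ k, p k → q k) :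
    valuesAt n B b p ⊆ valuesAt n B b q := by
  intro y hy
  rw [mem_valuesAt] at hy ⊢
  exact hy.imp_right fun ⟨k, h0, h1, hp, hk⟩ => ⟨k, h0, h1, h k hp, hk⟩

lemma hasRange_valuesAt_of_forall_not {n : ℤ} {B : ℤ → ℝ} {b : ℝ} {p : ℤ → Prop}
    (h : ∀ k, 0 ≤ k → k < n → ¬ p k) : HasRange (valuesAt n B b p) b b := by
  have : valuesAt n B b p = {b} := by
    ext y
    rw [mem_valuesAt, Set.mem_singleton_iff]
    exact ⟨fun hy => hy.elim id fun ⟨k, h0, h1, hp, _⟩ => absurd hp (h k h0 h1), .inl⟩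
  rw [this]
  exact ⟨isGLB_singleton, isLUB_singleton⟩

lemma HasRange.valuesAt_or {n : ℤ} {B : ℤ → ℝ} {b lo hi lo' hi' : ℝ} {p q r : ℤ → Prop}
    (hp : HasRange (valuesAt n B b p) lo hi) (hq : HasRange (valuesAt n B b q) lo' hi')
    (h : ∀ k, r k ↔ p k ∨ q k) :
    HasRange (valuesAt n B b r) (min lo lo') (max hi hi') := by
  have : valuesAt n B b r = valuesAt n B b p ∪ valuesAt n B b q := by
    ext y
    simp only [mem_valuesAt, Set.mem_union, h]
    grind
  rw [this]
  exact hp.union hq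

lemma HasRange.valuesAt_succ {n : ℤ} (hn : 0 ≤ n) {B : ℤ → ℝ} {b lo hi : ℝ} {p : ℤ → Prop}
    (h : HasRange (valuesAt n B b p) lo hi) (hp : p n) :
    HasRange (valuesAt (n + 1) B b p) (min lo (B n)) (max hi (B n)) := by
  have : valuesAt (n + 1) B b p = valuesAt n B b p ∪ {B n} := by
    ext y
    simp only [mem_valuesAt, Set.mem_union, Set.mem_singleton_iff, or_assoc]
    refine or_congr_right ⟨fun ⟨k, h0, h1, hk, e⟩ => ?_, ?_⟩
    · rcases eq_or_ne k n with rfl | hne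
      · exact .inr e.symm
      · exact .inl ⟨k, h0, by omega, hk, e⟩
    · rintro (⟨k, h0, h1, hk, e⟩ | e)
      · exact ⟨k, h0, by omega, hk, e⟩
      · exact ⟨n, hn, by omega, hp, e.symm⟩
  rw [this]
  exact h.union ⟨isGLB_singleton, isLUB_singleton⟩

lemma valuesAt_succ_of_not {n : ℤ} {B : ℤ → ℝ} {b : ℝ} {p : ℤ → Prop} (hp : ¬ p n) :
    valuesAt (n + 1) B b p = valuesAt n B b p := by
  ext y
  simp only [mem_valuesAt]
  refine or_congr_right ⟨fun ⟨k, h0, h1, hk, e⟩ => ?_, fun ⟨k, h0, h1, hk, e⟩ =>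
    ⟨k, h0, by omega, hk, e⟩⟩
  rcases eq_or_ne k n with rfl | hne
  · exact absurd hk hp
  · exact ⟨k, h0, by omega, hk, e⟩

/-- The bucket of `x` in the grid of buckets `[o + c δ, o + (c + 1) δ)`, where `0 ≤ c ≤ N`; all
other numbers lie in bucket `-1`. -/
noncomputable def bucket (N : ℤ) (o δ x : ℝ) : ℤ :=
  if N < max ⌊(x - o) / δ⌋ (-1) then -1 else max ⌊(x - o) / δ⌋ (-1)

lemma neg_one_le_bucket (N : ℤ) (o δ x : ℝ) : -1 ≤ bucket N o δ x := by
  unfold bucket; split_ifs <;> simp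

lemma bucket_le {N : ℤ} (hN : 0 ≤ N) (o δ x : ℝ) : bucket N o δ x ≤ N := by
  unfold bucket; split_ifs <;> omega

lemma bucket_eq_floor {N : ℤ} {o δ x : ℝ} (h : 0 ≤ ⌊(x - o) / δ⌋) (h' : ⌊(x - o) / δ⌋ ≤ N) :
    bucket N o δ x = ⌊(x - o) / δ⌋ := by
  unfold bucket; split_ifs <;> omega

lemma bucket_eq_floor_of_nonneg {N : ℤ} {o δ x : ℝ} (h : 0 ≤ bucket N o δ x) :
    bucket N o δ x = ⌊(x - o) / δ⌋ := by
  unfold bucket at *; split_ifs at * <;> omega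

/-- The values `B k`, and `b`, over the points that do not lie in the buckets `i, …, j - 1`. -/
def outside (n : ℤ) (A B : ℤ → ℝ) (b : ℝ) (N : ℤ) (o δ : ℝ) (i j : ℤ) : Set ℝ :=
  valuesAt n B b fun k => bucket N o δ (A k) < i ∨ j ≤ bucket N o δ (A k)

/-- The slab spanned by the buckets `i, …, j - 1` and the range of all remaining values form a
covering. -/
lemma feasible_of_hasRange_outside {n : ℤ} {A B : ℤ → ℝ} {b : ℝ} {N : ℤ} {o δ lo hi : ℝ}
    {i j : ℤ} (hδ : 0 < δ) (hi₀ : 0 ≤ i) (hij : i ≤ j)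
    (h : HasRange (outside n A B b N o δ i j) lo hi) :
    Feasible n A B (o + i * δ) (o + j * δ) lo hi (max (hi - lo) ((j - i : ℤ) * δ)) := by
  have hb := h.subset_Icc ((mem_valuesAt b).2 (.inl rfl))
  have hij' : (i : ℝ) ≤ j := by exact_mod_cast hij
  refine ⟨by gcongr, hb.1.trans hb.2, ?_, le_max_left _ _, fun k h0 h1 => ?_⟩
  · refine le_trans (le_of_eq ?_) (le_max_right _ _)
    push_cast; ring
  · by_cases hk : bucket N o δ (A k) < i ∨ j ≤ bucket N o δ (A k)
    · exact .inr (h.subset_Icc ((mem_valuesAt _).2 (.inr ⟨k, h0, h1, hk, rfl⟩)))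
    · push Not at hk
      rw [bucket_eq_floor_of_nonneg (by omega), Int.le_floor, Int.floor_lt, le_div_iff₀ hδ,
        div_lt_iff₀ hδ] at hk
      exact .inl ⟨by linarith, by linarith⟩

/-- Rounding the first slab outwards to the grid leaves only points of the second slab
uncovered. -/
lemma Feasible.exists_window {n : ℤ} {A B : ℤ → ℝ} {a b x₀ x₁ y₀ y₁ w W δ : ℝ} {N : ℤ}
    (h : Feasible n A B x₀ x₁ y₀ y₁ w) (ha : a ∈ Set.Icc x₀ x₁) (hb : b ∈ Set.Icc y₀ y₁)
    (hw : w ≤ 2 * W) (hδ : 0 < δ) (hN : N * δ = 4 * W) :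
    ∃ i j : ℤ, 0 ≤ i ∧ i ≤ j ∧ j ≤ N + 1 ∧
      outside n A B b N (a - W - W) δ i j ⊆ Set.Icc y₀ y₁ ∧ (j - i : ℤ) * δ ≤ w + 2 * δ := by
  -- As `|x₁ - x₀| ≤ 2 W` and `a ∈ [x₀, x₁]`, the first slab lies inside the grid.
  set o := a - W - W with ho
  have hx := h.left_width
  have h₀ : 0 ≤ ⌊(x₀ - o) / δ⌋ := Int.floor_nonneg.2 (div_nonneg (by linarith [ha.2]) hδ.le)
  have h₁ : ⌊(x₁ - o) / δ⌋ ≤ N := by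
    rw [← Int.floor_intCast (R := ℝ) N]
    refine Int.floor_mono ((div_le_iff₀ hδ).2 ?_)
    linarith [ha.1]
  have mono : ∀ {x x'}, x ≤ x' → ⌊(x - o) / δ⌋ ≤ ⌊(x' - o) / δ⌋ := fun hxx' =>
    Int.floor_mono (by gcongr)
  have h₀₁ := mono h.left_le
  refine ⟨⌊(x₀ - o) / δ⌋, ⌊(x₁ - o) / δ⌋ + 1, h₀, by omega, by omega, ?_, ?_⟩
  · intro y hy
    obtain rfl | ⟨k, h0, h1, hk, rfl⟩ := (mem_valuesAt _).1 hy
    · exact hb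
    · refine (h.covers k h0 h1).resolve_left fun hA => ?_
      have e₀ := mono hA.1
      have e₁ := mono hA.2
      rw [bucket_eq_floor (by omega) (by omega)] at hk
      omega
  · have e₀ := Int.lt_floor_add_one ((x₀ - o) / δ)
    have e₁ := Int.floor_le ((x₁ - o) / δ)
    rw [div_lt_iff₀ hδ] at e₀
    rw [le_div_iff₀ hδ] at e₁
    push_cast
    linarith

/-- The indices `q` and `r` maximise `z₂ B` and `z₁ A`, and `v` is at most `c` times the width of
any covering whose first slab contains `A q` and whose second slab contains `B r`. -/
def AnchoredBound (n : ℤ) (A B : ℤ → ℝ) (c v : ℝ) (z₁ z₂ : ℤ) : Prop :=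
  ∃ q r, (∀ k, 0 ≤ k → k < n → z₁ * A k ≤ z₁ * A r ∧ z₂ * B k ≤ z₂ * B q) ∧
    (0 ≤ q ∧ q < n) ∧ (0 ≤ r ∧ r < n) ∧
    ∀ x₀ x₁ y₀ y₁ w, Feasible n A B x₀ x₁ y₀ y₁ w → A q ∈ Set.Icc x₀ x₁ → B r ∈ Set.Icc y₀ y₁ →
      v ≤ c * w

lemma AnchoredBound.mono {n : ℤ} {A B : ℤ → ℝ} {c v v' : ℝ} {z₁ z₂ : ℤ}
    (h : AnchoredBound n A B c v z₁ z₂) (hv : v' ≤ v) : AnchoredBound n A B c v' z₁ z₂ := by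
  obtain ⟨q, r, hqr, hq, hr, h⟩ := h
  exact ⟨q, r, hqr, hq, hr, fun x₀ x₁ y₀ y₁ w hf ha hb => hv.trans (h x₀ x₁ y₀ y₁ w hf ha hb)⟩

/-- If the first slab misses some point, then it misses a point with an extreme value of `A`, which
therefore lies in the second slab; likewise with the roles exchanged. If one slab covers all points,
the other one can be moved to the anchor. -/
lemma Feasible.le_of_anchoredBound {n : ℤ} {A B : ℤ → ℝ} {c v x₀ x₁ y₀ y₁ w : ℝ}
    (hf : Feasible n A B x₀ x₁ y₀ y₁ w)
    (h : ∀ z₁ z₂ : ℤ, z₁ = 1 ∨ z₁ = -1 → z₂ = 1 ∨ z₂ = -1 → AnchoredBound n A B c v z₁ z₂) :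
    v ≤ c * w := by
  have hw : 0 ≤ w := (sub_nonneg.2 hf.left_le).trans hf.left_width
  by_cases hA : ∀ k, 0 ≤ k → k < n → A k ∈ Set.Icc x₀ x₁
  · obtain ⟨q, r, -, hq, hr, h⟩ := h 1 1 (.inl rfl) (.inl rfl)
    exact h x₀ x₁ (B r) (B r) w ⟨hf.left_le, le_rfl, hf.left_width, by simpa, fun k h0 h1 =>
      .inl (hA k h0 h1)⟩ (hA q hq.1 hq.2) ⟨le_rfl, le_rfl⟩
  by_cases hB : ∀ k, 0 ≤ k → k < n → B k ∈ Set.Icc y₀ y₁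
  · obtain ⟨q, r, -, hq, hr, h⟩ := h 1 1 (.inl rfl) (.inl rfl)
    exact h (A q) (A q) y₀ y₁ w ⟨le_rfl, hf.right_le, by simpa, hf.right_width, fun k h0 h1 =>
      .inr (hB k h0 h1)⟩ ⟨le_rfl, le_rfl⟩ (hB r hr.1 hr.2)
  have key : ∀ (F : ℤ → ℝ) (a b : ℝ), (¬ ∀ k, 0 ≤ k → k < n → F k ∈ Set.Icc a b) →
      ∃ z : ℤ, (z = 1 ∨ z = -1) ∧ ∀ r, (∀ k, 0 ≤ k → k < n → z * F k ≤ z * F r) →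
        F r ∉ Set.Icc a b := by
    intro F a b hF
    push Not at hF
    obtain ⟨k, h0, h1, hk⟩ := hF
    rw [Set.mem_Icc, not_and_or, not_le, not_le] at hk
    rcases hk with hk | hk
    · exact ⟨-1, .inr rfl, fun r hr hmem => by
        have := hr k h0 h1; push_cast at this; linarith [hmem.1]⟩
    · exact ⟨1, .inl rfl, fun r hr hmem => by
        have := hr k h0 h1; push_cast at this; linarith [hmem.2]⟩
  obtain ⟨z₁, hz₁, h₁⟩ := key A x₀ x₁ hA
  obtain ⟨z₂, hz₂, h₂⟩ := key B y₀ y₁ hB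
  obtain ⟨q, r, hqr, hq, hr, h⟩ := h z₁ z₂ hz₁ hz₂
  exact h x₀ x₁ y₀ y₁ w hf
    ((hf.covers q hq.1 hq.2).resolve_right (h₂ q fun k h0 h1 => (hqr k h0 h1).2))
    ((hf.covers r hr.1 hr.2).resolve_left (h₁ r fun k h0 h1 => (hqr k h0 h1).1))

/-! ### The program

Integer registers: 0 holds `n`, 2 the index of the current loop over points or buckets, 3 and 4 the
numbers `N` and `N + 1`, 5 and 6 the current window `(i, j)`; 1, 8 and 9 hold the constants `1`, `0`
and `-1`.

Real registers: 0 holds `ε`, 1 to 4 the directions, 5 to 8 the offsets of the best pair of slabs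
found so far and 9 a bound for its width, 10 the constant `0`, 11 and 12 the signs that select the
anchors, 13 and 14 the extreme values attained there, 15 and 16 the coordinates `A q` and `B r` of
the anchors, 17 the radius `W`, 18 and 19 the mesh `δ` and the origin of the grid, 23 and 24 the
range of the values before the window, 25 to 29 the range outside the window, its length, the
length of the window, and the maximum of these two lengths.

All other registers in use are temporary.

Real arrays: 2 and 3 hold the signed distances `A` and `B`, 4 and 5 the minimum and maximum of `B`
in each bucket, 6 and 7 the minimum and maximum of `B` from each bucket onwards. -/

namespace RealRAM

section Programs

open Instr

local instance : Coe Instr Prog := ⟨Prog.instr⟩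

/-- One point in `projections`. -/
def projectionsBody : Prog := seqs [
  rload 20 0 2, rload 21 1 2,
  rmul 22 2 20, rmul 23 1 21, rsub 24 23 22, rstore 2 2 24, rmin 5 5 24, rmax 6 6 24,
  rmul 22 4 20, rmul 23 3 21, rsub 24 23 22, rstore 3 2 24,
  iadd 2 2 1]

/-- Stores the signed distances `A` and `B` of the points along the two normals. The initial best
pair consists of a slab that contains all points and the origin, and of a line through the
origin. It relies on registers 5 to 8 being zero at the start. -/
def projections : Prog := seqs [
  iconst 1 1, iconst 9 (-1),
  .loop (.ilt 2 0) projectionsBody,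
  rsub 9 6 5]

/-- `d := max a b` for integers. -/
def imax (d a b : ℕ) : Prog := .cond (.ile a b) (icopy d b) (icopy d a)

/-- If `x < y`, then `d := a`. -/
def rcopyIfLt (x y d a : ℕ) : Prog := .cond (.rlt x y) (rcopy d a) (rcopy d d)

/-- If `x < y`, then `d := a`, for integers. -/
def icopyIfLt (x y d a : ℕ) : Prog := .cond (.ilt x y) (icopy d a) (icopy d d)

/-- One point in `anchors`. -/
def anchorsBody : Prog := seqs [
  rload 20 2 2, rload 21 3 2, rmul 22 11 20, rmul 23 12 21,
  rcopyIfLt 13 22 16 21, rmax 13 13 22, rcopyIfLt 14 23 15 20, rmax 14 14 23,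
  iadd 2 2 1]

/-- Finds the points `r` and `q` that maximise `z₁ A` and `z₂ B`, where `z₁` and `z₂` are the signs
in registers 11 and 12, and stores `A q` and `B r`. -/
def anchors : Prog := seqs [
  rload 15 2 8, rload 16 3 8, rmul 13 11 15, rmul 14 12 16, iconst 2 0,
  .loop (.ilt 2 0) anchorsBody]

/-- One point in `radius`. -/
def radiusBody : Prog := seqs [
  rload 20 2 2, rsub 22 20 15, rsub 23 15 20, rmax 24 22 23,
  rload 20 3 2, rsub 22 20 16, rsub 23 16 20, rmax 25 22 23,
  rmin 24 24 25, rmax 17 17 24, iadd 2 2 1]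

/-- Computes `W = max_k min(|A k - A q|, |B k - B r|)`. -/
def radius : Prog := seqs [rcopy 17 10, iconst 2 0, .loop (.ilt 2 0) radiusBody]

/-- Records the two slabs of width `2 W` centred at the anchors, if they improve on the best pair. -/
def crude : Prog := seqs [
  radd 20 17 17,
  .cond (.rlt 20 9) (seqs [
    rsub 5 15 17, radd 6 15 17, rsub 7 16 17, radd 8 16 17, rcopy 9 20]) .skip]

/-- Lays a grid of `N = ⌊8 / ε⌋ + 1` buckets over `[A q - 2 W, A q + 2 W]`. There is one more bucket,
of index `N`, for the right end. -/
def grid : Prog := seqs [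
  iconst 7 8, ofInt 20 7, rdiv 20 20 0, floor 3 20, iadd 3 3 1, iadd 4 3 1,
  iconst 7 4, ofInt 20 7, rmul 20 20 17, ofInt 21 3, rdiv 18 20 21,
  rsub 19 15 17, rsub 19 19 17]

/-- One bucket in `clear`. -/
def clearBody : Prog := seqs [rstore 4 2 16, rstore 5 2 16, iadd 2 2 1]

/-- Initialises the ranges of the buckets `-1, …, N` with the value at the anchor. -/
def clear : Prog := seqs [icopy 2 9, .loop (.ilt 2 4) clearBody]

/-- One point in `distribute`. -/
def distributeBody : Prog := seqs [
  rload 20 2 2, rsub 20 20 19, rdiv 20 20 18, floor 7 20, imax 7 7 9,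
  icopyIfLt 3 7 7 9,
  rload 21 3 2,
  rload 22 4 7, rmin 22 22 21, rstore 4 7 22,
  rload 22 5 7, rmax 22 22 21, rstore 5 7 22,
  iadd 2 2 1]

/-- Adds each point to the range of its bucket. -/
def distribute : Prog := seqs [iconst 2 0, .loop (.ilt 2 0) distributeBody]

/-- One bucket in `suffixes`. -/
def suffixesBody : Prog := seqs [
  rload 20 6 2, rload 21 7 2, isub 2 2 1,
  rload 22 4 2, rmin 20 20 22, rstore 6 2 20,
  rload 22 5 2, rmax 21 21 22, rstore 7 2 21]

/-- Computes the ranges of the final segments of the sequence of buckets. -/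
def suffixes : Prog := seqs [
  icopy 2 4, rstore 6 2 16, rstore 7 2 16, .loop (.ilt 8 2) suffixesBody]

/-- Computes the cost of the current window `(i, j)`. -/
def walkMeasure : Prog := seqs [
  rload 20 6 6, rmin 25 23 20, rload 20 7 6, rmax 26 24 20, rsub 27 26 25,
  isub 7 6 5, ofInt 28 7, rmul 28 28 18, rmax 29 27 28]

/-- Records the pair of slabs given by the current window, if it improves on the best pair. -/
def walkRecord : Prog :=
  .cond (.rlt 29 9) (seqs [
    ofInt 20 5, rmul 20 20 18, radd 5 19 20, ofInt 20 6, rmul 20 20 18, radd 6 19 20,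
    rcopy 7 25, rcopy 8 26, rcopy 9 29]) .skip

/-- Moves the end of the window if the range outside is at least as long as the window, and the
beginning of the window otherwise. -/
def walkMove : Prog :=
  .cond (.rle 28 27) (iadd 6 6 1) (seqs [
    rload 20 4 5, rmin 23 23 20, rload 20 5 5, rmax 24 24 20, iadd 5 5 1])

/-- One window in `walk`. -/
def walkBody : Prog := seqs [walkMeasure, walkRecord, walkMove]

/-- A walk through the windows `(i, j)`, in which each of `i` and `j` only increases. -/
def walk : Prog := seqs [
  iconst 5 0, iconst 6 0, rload 23 4 9, rload 24 5 9, .loop (.ile 6 4) walkBody]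

/-- Tests the windows of the grid. -/
def refineGrid : Prog := seqs [grid, clear, distribute, suffixes, walk]

/-- One attempt at improving the best pair, for given signs. -/
def improve : Prog := seqs [anchors, radius, crude, .cond (.rlt 10 17) refineGrid .skip]

/-- One attempt at improving the best pair, for the signs `z₁` and `z₂`. -/
def improveWith (z₁ z₂ : ℤ) : Prog := seqs [
  iconst 7 z₁, ofInt 11 7, iconst 7 z₂, ofInt 12 7, improve]

/-- The algorithm: an attempt for every choice of signs, after which the best pair is reported. -/
def twoSlabs : Prog := seqs [
  projections, improveWith 1 1, improveWith 1 (-1), improveWith (-1) 1, improveWith (-1) (-1),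
  rcopy 0 5, rcopy 1 6, rcopy 2 7, rcopy 3 8]

end Programs

@[simp] lemma eval_rcopyIfLt (x y d a : ℕ) (s : State) :
    (rcopyIfLt x y d a).eval s =
      s.setR d (if s.rreg x < s.rreg y then s.rreg a else s.rreg d) := by
  by_cases h : s.rreg x < s.rreg y <;>
    simp [rcopyIfLt, Prog.eval, Instr.exec, Test.Holds, h]

@[simp] lemma eval_icopyIfLt (x y d a : ℕ) (s : State) :
    (icopyIfLt x y d a).eval s =
      s.setI d (if s.ireg x < s.ireg y then s.ireg a else s.ireg d) := by
  by_cases h : s.ireg x < s.ireg y <;>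
    simp [icopyIfLt, Prog.eval, Instr.exec, Test.Holds, h]

@[simp] lemma eval_imax (d a b : ℕ) (s : State) :
    (imax d a b).eval s = s.setI d (max (s.ireg a) (s.ireg b)) := by
  by_cases h : s.ireg a ≤ s.ireg b
  · simp [imax, Prog.eval, Test.Holds, Instr.exec, h]
  · simp [imax, Prog.eval, Test.Holds, Instr.exec, h, le_of_not_ge h]

/-- The registers and arrays that are never changed after `projections` have their proper values. -/
structure Ready (n : ℤ) (A B : ℤ → ℝ) (ε : ℝ) (s : State) : Prop where
  size : s.ireg 0 = n
  one : s.ireg 1 = 1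
  zero : s.ireg 8 = 0
  negOne : s.ireg 9 = -1
  eps : s.rreg 0 = ε
  rzero : s.rreg 10 = 0
  arrA : s.rarr 2 = A
  arrB : s.rarr 3 = B

/-- The best pair of slabs recorded in the state is a covering of the recorded width. -/
def Record (n : ℤ) (A B : ℤ → ℝ) (s : State) : Prop :=
  Feasible n A B (s.rreg 5) (s.rreg 6) (s.rreg 7) (s.rreg 8) (s.rreg 9)

/-! ### Preparations, anchors and radius -/

lemma achieves_projections {s : State} (hn : 0 ≤ s.ireg 0) (hi : ∀ r, r ≠ 0 → s.ireg r = 0)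
    (hr : ∀ r, 5 ≤ r → s.rreg r = 0) :
    Achieves projections s (20 * (s.ireg 0).toNat + 20) fun s' => ∃ A B : ℤ → ℝ,
      Ready (s.ireg 0) A B (s.rreg 0) s' ∧ Record (s.ireg 0) A B s' ∧
      ∀ k, 0 ≤ k → k < s.ireg 0 →
        A k = s.rreg 1 * s.rarr 1 k - s.rreg 2 * s.rarr 0 k ∧
        B k = s.rreg 3 * s.rarr 1 k - s.rreg 4 * s.rarr 0 k := by
  have key := Achieves.for (c := 2) (e := 0) (P := projectionsBody) (T := 17) (a := 0)
    (b := s.ireg 0) (s₀ := (s.setI 1 1).setI 9 (-1))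
    (fun k s' => s'.rreg 5 ≤ 0 ∧ 0 ≤ s'.rreg 6 ∧ ∀ j, 0 ≤ j → j < k →
      s'.rarr 2 j ∈ Set.Icc (s'.rreg 5) (s'.rreg 6) ∧
      s'.rarr 2 j = s.rreg 1 * s.rarr 1 j - s.rreg 2 * s.rarr 0 j ∧
      s'.rarr 3 j = s.rreg 3 * s.rarr 1 j - s.rreg 4 * s.rarr 0 j)
    hn rfl (by simp [hi]) (by simp) (by simp +contextual [hr]) ?_
  · refine Achieves.mono (.seq (.instr (.seq (.instr (.seq (key.mono le_rfl fun s' h =>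
      .seq (.instr (.skip ?_)))))))) (by omega) fun _ h => h
    obtain ⟨hF, h5, h6, hA⟩ := h
    refine ⟨s'.rarr 2, s'.rarr 3, ⟨?_, ?_, ?_, ?_, ?_, ?_, rfl, rfl⟩, ?_, ?_⟩
    · simpa [Instr.exec] using hF.ireg 0 rfl
    · simpa [Instr.exec] using hF.ireg 1 rfl
    · simpa [Instr.exec, hi] using hF.ireg 8 rfl
    · simpa [Instr.exec] using hF.ireg 9 rfl
    · simpa [Instr.exec] using hF.rreg 0 rfl
    · simpa [Instr.exec, hr] using hF.rreg 10 rfl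
    · have h7 := hF.rreg 7 rfl
      have h8 := hF.rreg 8 rfl
      simp only [State.rreg_setI, hr 7 (by omega), hr 8 (by omega)] at h7 h8
      constructor <;> simp [Instr.exec, h7, h8]
      · linarith
      · linarith
      · intro k hk hkn
        exact .inl (hA k hk hkn).1
    · intro k hk hkn
      exact (hA k hk hkn).2
  · rintro k s' hF hk hkn hc ⟨h5, h6, hA⟩
    refine .of_eval rfl (by decide) ?_
    have f1 := hF.ireg 1 rfl
    have r1 := hF.rreg 1 rfl
    have r2 := hF.rreg 2 rfl
    have r3 := hF.rreg 3 rfl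
    have r4 := hF.rreg 4 rfl
    have a0 := hF.rarr 0 rfl
    have a1 := hF.rarr 1 rfl
    simp only [State.ireg_setI, State.rreg_setI, State.rarr_setI] at f1 r1 r2 r3 r4 a0 a1
    norm_num at f1
    simp [projectionsBody, seqs, Prog.eval, Instr.exec, f1, r1, r2, r3, r4, a0, a1, hc, h5, h6]
    intro j hj hjk
    rcases eq_or_ne j k with rfl | hne
    · simp
    · have := hA j hj (by omega)
      simp only [Function.update_of_ne hne]
      exact ⟨⟨.inl this.1.1, .inl this.1.2⟩, this.2⟩

/-- The program writes to none of the registers and arrays mentioned in `Ready`. -/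
def keepsInput (P : Prog) : Bool :=
  !P.writes false 0 && !P.writes false 1 && !P.writes false 8 && !P.writes false 9 &&
  !P.writes true 0 && !P.writes true 10 && !P.writesArr 2 && !P.writesArr 3

lemma Ready.of_frame {n : ℤ} {A B : ℤ → ℝ} {ε : ℝ} {P : Prog} {s s' : State}
    (h : Ready n A B ε s) (hF : Frame P s s') (hP : keepsInput P = true) : Ready n A B ε s' := by
  simp only [keepsInput, Bool.and_eq_true, Bool.not_eq_true'] at hP
  obtain ⟨⟨⟨⟨⟨⟨⟨h0, h1⟩, h8⟩, h9⟩, r0⟩, r10⟩, a2⟩, a3⟩ := hP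
  exact ⟨(hF.ireg _ h0).trans h.size, (hF.ireg _ h1).trans h.one, (hF.ireg _ h8).trans h.zero,
    (hF.ireg _ h9).trans h.negOne, (hF.rreg _ r0).trans h.eps, (hF.rreg _ r10).trans h.rzero,
    (hF.rarr _ a2).trans h.arrA, (hF.rarr _ a3).trans h.arrB⟩

variable {n : ℤ} {A B : ℤ → ℝ} {ε : ℝ} {s : State}

lemma achieves_anchors (h : Ready n A B ε s) (hn : 0 < n) :
    Achieves anchors s (20 * n.toNat + 20) fun s' => ∃ q r,
      (0 ≤ q ∧ q < n) ∧ (0 ≤ r ∧ r < n) ∧ s'.rreg 15 = A q ∧ s'.rreg 16 = B r ∧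
      ∀ k, 0 ≤ k → k < n →
        s.rreg 11 * A k ≤ s.rreg 11 * A r ∧ s.rreg 12 * B k ≤ s.rreg 12 * B q := by
  refine Achieves.mono (.seq (.instr (.seq (.instr (.seq (.instr (.seq (.instr (.seq (.instr
    (.seq ((Achieves.for (T := 18) (a := 0) (b := n) (fun k s' => ∃ q r,
      (0 ≤ q ∧ q < n) ∧ (0 ≤ r ∧ r < n) ∧ s'.rreg 15 = A q ∧ s'.rreg 16 = B r ∧
      s'.rreg 13 = s.rreg 11 * A r ∧ s'.rreg 14 = s.rreg 12 * B q ∧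
      ∀ j, 0 ≤ j → j < k →
        s.rreg 11 * A j ≤ s.rreg 11 * A r ∧ s.rreg 12 * B j ≤ s.rreg 12 * B q)
      hn.le rfl ?_ ?_ ?_ ?_).mono le_rfl fun s' ⟨_, q, r, hq, hr, e15, e16, _, _, hA⟩ =>
        .skip ⟨q, r, hq, hr, e15, e16, hA⟩))))))))))))
    (by omega) fun _ h => h
  · simp [Instr.exec]
  · simp [Instr.exec, h.size]
  · refine ⟨0, 0, by omega, by omega, ?_⟩
    simp [Instr.exec, h.arrA, h.arrB, h.zero]
    intros; omega
  · rintro k s' hF hk hkn hc ⟨q, r, hq, hr, e15, e16, e13, e14, hA⟩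
    refine .of_eval rfl (by decide) ?_
    have f1 := (hF.ireg 1 rfl).trans (by simpa [Instr.exec] using h.one)
    have r11 : s'.rreg 11 = s.rreg 11 := (hF.rreg 11 rfl).trans (by simp [Instr.exec])
    have r12 : s'.rreg 12 = s.rreg 12 := (hF.rreg 12 rfl).trans (by simp [Instr.exec])
    have a2 := (hF.rarr 2 rfl).trans (by simpa [Instr.exec] using h.arrA)
    have a3 := (hF.rarr 3 rfl).trans (by simpa [Instr.exec] using h.arrB)
    have hA' : ∀ j, 0 ≤ j → j < k + 1 → j = k ∨ s.rreg 11 * A j ≤ s.rreg 11 * A r ∧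
        s.rreg 12 * B j ≤ s.rreg 12 * B q := fun j h0 h1 =>
      (eq_or_ne j k).imp_right fun hne => hA j h0 (by omega)
    refine ⟨by simp [anchorsBody, seqs, Prog.eval, Instr.exec, f1, hc],
      if s.rreg 12 * B q < s.rreg 12 * B k then k else q,
      if s.rreg 11 * A r < s.rreg 11 * A k then k else r, by grind, by grind, ?_, ?_, ?_, ?_, ?_⟩
    · simp [anchorsBody, seqs, Prog.eval, Instr.exec, hc, r12, a2, a3, e14, e15, apply_ite A]
    · simp [anchorsBody, seqs, Prog.eval, Instr.exec, hc, r11, a2, a3, e13, e16, apply_ite B]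
    · simp [anchorsBody, seqs, Prog.eval, Instr.exec, hc, r11, a2, e13]
      split_ifs with h'
      · exact max_eq_right h'.le
      · exact max_eq_left (not_lt.1 h')
    · simp [anchorsBody, seqs, Prog.eval, Instr.exec, hc, r12, a3, e14]
      split_ifs with h'
      · exact max_eq_right h'.le
      · exact max_eq_left (not_lt.1 h')
    · intro j h0 h1
      have := hA' j h0 h1
      constructor <;> split_ifs <;> rcases this with rfl | this <;> linarith

/-- The third clause says that `W` is at most the width of any covering whose slabs contain the
anchors. -/
lemma achieves_radius (h : Ready n A B ε s) (hn : 0 < n) :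
    Achieves radius s (21 * n.toNat + 20) fun s' => 0 ≤ s'.rreg 17 ∧
      (∀ k, 0 ≤ k → k < n → |A k - s.rreg 15| ≤ s'.rreg 17 ∨ |B k - s.rreg 16| ≤ s'.rreg 17) ∧
      ∀ u, 0 ≤ u → (∀ k, 0 ≤ k → k < n → |A k - s.rreg 15| ≤ u ∨ |B k - s.rreg 16| ≤ u) →
        s'.rreg 17 ≤ u := by
  refine Achieves.mono (.seq (.instr (.seq (.instr
    (.seq ((Achieves.for (T := 19) (a := 0) (b := n) (fun m s' => 0 ≤ s'.rreg 17 ∧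
      (∀ k, 0 ≤ k → k < m → |A k - s.rreg 15| ≤ s'.rreg 17 ∨ |B k - s.rreg 16| ≤ s'.rreg 17) ∧
      ∀ u, 0 ≤ u → (∀ k, 0 ≤ k → k < m → |A k - s.rreg 15| ≤ u ∨ |B k - s.rreg 16| ≤ u) →
        s'.rreg 17 ≤ u)
      hn.le rfl ?_ ?_ ?_ ?_).mono le_rfl fun s' hs => .skip hs.2))))))
    (by omega) fun _ h => h
  · simp [Instr.exec]
  · simp [Instr.exec, h.size]
  · simp [Instr.exec, h.rzero]
    exact ⟨by intros; omega, by intros; assumption⟩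
  · rintro k s' hF hk hkn hc ⟨h0, hle, hleast⟩
    refine .of_eval rfl (by decide) ?_
    have f1 := (hF.ireg 1 rfl).trans (by simpa [Instr.exec] using h.one)
    have r15 : s'.rreg 15 = s.rreg 15 := (hF.rreg 15 rfl).trans (by simp [Instr.exec])
    have r16 : s'.rreg 16 = s.rreg 16 := (hF.rreg 16 rfl).trans (by simp [Instr.exec])
    have a2 := (hF.rarr 2 rfl).trans (by simpa [Instr.exec] using h.arrA)
    have a3 := (hF.rarr 3 rfl).trans (by simpa [Instr.exec] using h.arrB)
    have e : ∀ x y : ℝ, max (x - y) (y - x) = |x - y| := fun x y => by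
      rw [abs_eq_max_neg, neg_sub]
    simp only [radiusBody, seqs, Prog.eval, Instr.exec]
    simp [f1, hc, r15, r16, a2, a3, e]
    refine ⟨fun j hj hjk => ?_, fun u hu hju => ⟨?_, ?_⟩⟩
    · rcases eq_or_ne j k with rfl | hne
      · rcases le_total |A j - s.rreg 15| |B j - s.rreg 16| with h' | h' <;> simp [h']
      · exact (hle j hj (by omega)).imp .inl .inl
    · exact hleast u hu fun j hj hjk => hju j hj (by omega)
    · exact hju k hk le_rfl

lemma achieves_crude (h : Record n A B s) (h0 : 0 ≤ s.rreg 17)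
    (hW : ∀ k, 0 ≤ k → k < n → |A k - s.rreg 15| ≤ s.rreg 17 ∨ |B k - s.rreg 16| ≤ s.rreg 17) :
    Achieves crude s 20 fun s' =>
      Record n A B s' ∧ s'.rreg 9 ≤ s.rreg 9 ∧ s'.rreg 9 ≤ 2 * s.rreg 17 := by
  refine .of_eval rfl (by decide) ?_
  simp [crude, seqs, Prog.eval, Test.Holds, Instr.exec]
  split_ifs with hlt
  · refine ⟨⟨?_, ?_, ?_, ?_, fun k hk hkn => ?_⟩, ?_, ?_⟩
    any_goals simp
    any_goals linarith
    have := hW k hk hkn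
    simp only [abs_le] at this
    refine this.imp ?_ ?_ <;> rintro ⟨h₁, h₂⟩ <;> constructor <;> linarith
  · exact ⟨h, le_rfl, by simpa [two_mul] using hlt⟩

end RealRAM

/-! ### Filling the grid and walking through the windows -/

namespace RealRAM

/-- The state after `grid`: on top of `Ready`, registers hold the number `N` of buckets, the value
`b` at the second anchor, and the width `δ` and origin `o` of the grid. -/
structure OnGrid (n : ℤ) (A B : ℤ → ℝ) (ε b : ℝ) (N : ℤ) (o δ : ℝ) (s : State) : Prop
    extends Ready n A B ε s where
  count : s.ireg 3 = N
  count_succ : s.ireg 4 = N + 1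
  base : s.rreg 16 = b
  mesh : s.rreg 18 = δ
  origin : s.rreg 19 = o

/-- The program writes to none of the registers and arrays mentioned in `OnGrid`. -/
def keepsGrid (P : Prog) : Bool :=
  keepsInput P && !P.writes false 3 && !P.writes false 4 && !P.writes true 16 &&
  !P.writes true 18 && !P.writes true 19

variable {n : ℤ} {A B : ℤ → ℝ} {ε b : ℝ} {N : ℤ} {o δ : ℝ} {s : State}

lemma OnGrid.of_frame {P : Prog} {s' : State} (h : OnGrid n A B ε b N o δ s)
    (hF : Frame P s s') (hP : keepsGrid P = true) : OnGrid n A B ε b N o δ s' := by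
  simp only [keepsGrid, Bool.and_eq_true, Bool.not_eq_true'] at hP
  obtain ⟨⟨⟨⟨⟨hP, h3⟩, h4⟩, r16⟩, r18⟩, r19⟩ := hP
  exact ⟨h.toReady.of_frame hF hP, (hF.ireg _ h3).trans h.count,
    (hF.ireg _ h4).trans h.count_succ, (hF.rreg _ r16).trans h.base,
    (hF.rreg _ r18).trans h.mesh, (hF.rreg _ r19).trans h.origin⟩

lemma achieves_grid (h : Ready n A B ε s) (hε : 0 < ε) (hW : 0 < s.rreg 17) :
    Achieves grid s 20 fun s' => ∃ (N : ℤ) (δ : ℝ),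
      OnGrid n A B ε (s.rreg 16) N (s.rreg 15 - s.rreg 17 - s.rreg 17) δ s' ∧
      N = ⌊8 / ε⌋ + 1 ∧ 0 < δ ∧ N * δ = 4 * s.rreg 17 ∧ 2 * δ ≤ ε * s.rreg 17 := by
  -- The choice of `N > 8 / ε` makes `2 δ = 8 W / N` at most `ε W`.
  have h8 : 8 / ε < ((⌊8 / ε⌋ + 1 : ℤ) : ℝ) := by exact_mod_cast Int.lt_floor_add_one (8 / ε)
  have hN : (0 : ℝ) < ((⌊8 / ε⌋ + 1 : ℤ) : ℝ) := lt_trans (by positivity) h8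
  refine (Achieves.of_eval (T := 20) rfl (by decide)
    (Q := fun s' => s'.ireg 3 = ⌊8 / ε⌋ + 1 ∧ s'.ireg 4 = ⌊8 / ε⌋ + 1 + 1 ∧
      s'.rreg 18 = 4 * s.rreg 17 / ((⌊8 / ε⌋ + 1 : ℤ) : ℝ) ∧
      s'.rreg 19 = s.rreg 15 - s.rreg 17 - s.rreg 17) ?_).frame.mono le_rfl
    fun s' ⟨hF, h3, h4, h18, h19⟩ => ⟨_, _, ⟨h.of_frame hF rfl, h3, h4, hF.rreg 16 rfl, h18, h19⟩,
      rfl, by positivity, mul_div_cancel₀ _ hN.ne', ?_⟩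
  · simp [grid, seqs, Prog.eval, Instr.exec, h.eps, h.one]
  · rw [← mul_div_assoc, div_le_iff₀ hN]
    rw [div_lt_iff₀ hε] at h8
    nlinarith

lemma achieves_clear (h : OnGrid n A B ε b N o δ s) (hN : 0 ≤ N) :
    Achieves clear s (20 * N.toNat + 20) fun s' =>
      ∀ c, -1 ≤ c → c ≤ N → s'.rarr 4 c = b ∧ s'.rarr 5 c = b := by
  refine Achieves.mono (.seq (.instr (.seq ((Achieves.for (T := 3) (a := -1) (b := N + 1)
    (fun k s' => ∀ c, -1 ≤ c → c < k → s'.rarr 4 c = b ∧ s'.rarr 5 c = b)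
      (by omega) rfl ?_ ?_ ?_ ?_).mono le_rfl fun s' hs => .skip fun c h0 h1 =>
        hs.2 c h0 (by omega))))) (by omega) fun _ h => h
  · simp [Instr.exec, h.negOne]
  · simp [Instr.exec, h.count_succ]
  · intros; omega
  · rintro k s' hF hk hkn hc hI
    refine .of_eval rfl (by decide) ?_
    have f1 := (hF.ireg 1 rfl).trans (by simpa [Instr.exec] using h.one)
    have r16 : s'.rreg 16 = b := (hF.rreg 16 rfl).trans (by simp [Instr.exec, h.base])
    simp [clearBody, seqs, Prog.eval, Instr.exec, f1, hc, r16]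
    intro c h0 h1
    rcases eq_or_ne c k with rfl | hne
    · simp
    · simpa [hne] using hI c h0 (by omega)

lemma achieves_distribute (h : OnGrid n A B ε b N o δ s) (hn : 0 ≤ n)
    (hclear : ∀ c, -1 ≤ c → c ≤ N → s.rarr 4 c = b ∧ s.rarr 5 c = b) :
    Achieves distribute s (30 * n.toNat + 30) fun s' => ∀ c, -1 ≤ c → c ≤ N →
      HasRange (valuesAt n B b fun k => bucket N o δ (A k) = c) (s'.rarr 4 c) (s'.rarr 5 c) := by
  refine Achieves.mono (.seq (.instr (.seq ((Achieves.for (T := 26) (a := 0) (b := n)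
    (fun m s' => ∀ c, -1 ≤ c → c ≤ N →
      HasRange (valuesAt m B b fun k => bucket N o δ (A k) = c) (s'.rarr 4 c) (s'.rarr 5 c))
      hn rfl ?_ ?_ ?_ ?_).mono le_rfl fun s' hs => .skip hs.2)))) (by omega) fun _ h => h
  · simp [Instr.exec]
  · simp [Instr.exec, h.size]
  · intro c h0 h1
    simp only [Instr.exec, State.rarr_setI, hclear c h0 h1]
    exact hasRange_valuesAt_of_forall_not fun k _ _ => by omega
  · rintro m s' hF hm hmn hc hI
    refine .of_eval rfl (by decide) ?_
    have f1 := (hF.ireg 1 rfl).trans (by simpa [Instr.exec] using h.one)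
    have f9 := (hF.ireg 9 rfl).trans (by simpa [Instr.exec] using h.negOne)
    have f3 : s'.ireg 3 = N := (hF.ireg 3 rfl).trans (by simp [Instr.exec, h.count])
    have r18 : s'.rreg 18 = δ := (hF.rreg 18 rfl).trans (by simp [Instr.exec, h.mesh])
    have r19 : s'.rreg 19 = o := (hF.rreg 19 rfl).trans (by simp [Instr.exec, h.origin])
    have a2 := (hF.rarr 2 rfl).trans (by simpa [Instr.exec] using h.arrA)
    have a3 := (hF.rarr 3 rfl).trans (by simpa [Instr.exec] using h.arrB)
    have ev : (distributeBody.eval s').ireg 2 = m + 1 := by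
      simp [distributeBody, seqs, Prog.eval, Instr.exec, f1, hc]
    have ev4 : (distributeBody.eval s').rarr 4 = Function.update (s'.rarr 4) (bucket N o δ (A m))
        (min (s'.rarr 4 (bucket N o δ (A m))) (B m)) := by
      simp [distributeBody, seqs, Prog.eval, Instr.exec, hc, f9, f3, r18, r19, a2, a3, bucket]
    have ev5 : (distributeBody.eval s').rarr 5 = Function.update (s'.rarr 5) (bucket N o δ (A m))
        (max (s'.rarr 5 (bucket N o δ (A m))) (B m)) := by
      simp [distributeBody, seqs, Prog.eval, Instr.exec, hc, f9, f3, r18, r19, a2, a3, bucket]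
    refine ⟨ev, fun c h0 h1 => ?_⟩
    rw [ev4, ev5]
    by_cases hbc : bucket N o δ (A m) = c
    · subst hbc
      simpa using (hI _ h0 h1).valuesAt_succ hm rfl
    · rw [valuesAt_succ_of_not (by exact hbc), Function.update_of_ne (Ne.symm hbc),
        Function.update_of_ne (Ne.symm hbc)]
      exact hI c h0 h1

lemma achieves_suffixes (h : OnGrid n A B ε b N o δ s) (hN : 0 ≤ N)
    (hcells : ∀ c, -1 ≤ c → c ≤ N →
      HasRange (valuesAt n B b fun k => bucket N o δ (A k) = c) (s.rarr 4 c) (s.rarr 5 c)) :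
    Achieves suffixes s (20 * N.toNat + 40) fun s' => ∀ j, 0 ≤ j → j ≤ N + 1 →
      HasRange (valuesAt n B b fun k => j ≤ bucket N o δ (A k)) (s'.rarr 6 j) (s'.rarr 7 j) := by
  refine Achieves.mono (.seq (.instr (.seq (.instr (.seq (.instr (.seq ((Achieves.loop (T := 13)
    (fun m s' => s'.ireg 2 = m ∧ (m : ℤ) ≤ N + 1 ∧ ∀ j : ℤ, m ≤ j → j ≤ N + 1 →
      HasRange (valuesAt n B b fun k => j ≤ bucket N o δ (A k)) (s'.rarr 6 j) (s'.rarr 7 j))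
      ?_ (N + 1).toNat ?_).mono le_rfl fun s' hs => .skip ?_)))))))) (by omega) fun _ h => h
  · rintro m s' hF hc ⟨hm, hmN, hI⟩
    have f1 : s'.ireg 1 = 1 := (hF.ireg 1 rfl).trans (by simp [Instr.exec, h.one])
    have f8 : s'.ireg 8 = 0 := (hF.ireg 8 rfl).trans (by simp [Instr.exec, h.zero])
    refine .of_eval rfl (by decide) ?_
    have a4 : s'.rarr 4 = s.rarr 4 := (hF.rarr 4 rfl).trans (by simp [Instr.exec])
    have a5 : s'.rarr 5 = s.rarr 5 := (hF.rarr 5 rfl).trans (by simp [Instr.exec])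
    simp only [Test.Holds, f8, hm] at hc
    refine ⟨m - 1, by omega, ?_, by omega, fun j h0 h1 => ?_⟩
    · simp [suffixesBody, seqs, Prog.eval, Instr.exec, f1, hm]
      omega
    · rcases eq_or_ne j (m - 1) with rfl | hne
      · simp [suffixesBody, seqs, Prog.eval, Instr.exec, f1, hm, a4, a5]
        refine (hI m le_rfl hmN).valuesAt_or (hcells (m - 1) (by omega) (by omega)) fun k => ?_
        omega
      · simp [suffixesBody, seqs, Prog.eval, Instr.exec, f1, hm, hne]
        exact hI j (by omega) h1
  · refine ⟨?_, by omega, fun j h0 h1 => ?_⟩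
    · simp [Instr.exec, h.count_succ]; omega
    · obtain rfl : j = N + 1 := by omega
      simp [Instr.exec, h.count_succ, h.base]
      refine hasRange_valuesAt_of_forall_not fun k _ _ => ?_
      have := bucket_le hN o δ (A k)
      omega
  · obtain ⟨hF, hc, m, hm, hmN, hI⟩ := hs
    have e8 : s'.ireg 8 = 0 := (hF.ireg 8 rfl).trans (by simp [Instr.exec, h.zero])
    simp only [Test.Holds, e8, hm] at hc
    intro j h0 h1
    exact hI j (by omega) h1

/-- The part of the state that the walk only reads: the grid, the ranges of the buckets and the
ranges of the final segments of buckets. -/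
structure Tabulated (n : ℤ) (A B : ℤ → ℝ) (ε b : ℝ) (N : ℤ) (o δ : ℝ) (s : State) : Prop
    extends OnGrid n A B ε b N o δ s where
  cells : ∀ c, -1 ≤ c → c ≤ N →
    HasRange (valuesAt n B b fun k => bucket N o δ (A k) = c) (s.rarr 4 c) (s.rarr 5 c)
  suffixes : ∀ j, 0 ≤ j → j ≤ N + 1 →
    HasRange (valuesAt n B b fun k => j ≤ bucket N o δ (A k)) (s.rarr 6 j) (s.rarr 7 j)

/-- The program writes to none of the registers and arrays mentioned in `Tabulated`. -/
def keepsTables (P : Prog) : Bool :=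
  keepsGrid P && !P.writesArr 4 && !P.writesArr 5 && !P.writesArr 6 && !P.writesArr 7

lemma Tabulated.of_frame {P : Prog} {s' : State} (h : Tabulated n A B ε b N o δ s)
    (hF : Frame P s s') (hP : keepsTables P = true) : Tabulated n A B ε b N o δ s' := by
  simp only [keepsTables, Bool.and_eq_true, Bool.not_eq_true'] at hP
  obtain ⟨⟨⟨⟨hP, a4⟩, a5⟩, a6⟩, a7⟩ := hP
  refine ⟨h.toOnGrid.of_frame hF hP, ?_, ?_⟩
  · rw [hF.rarr 4 a4, hF.rarr 5 a5]; exact h.cells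
  · rw [hF.rarr 6 a6, hF.rarr 7 a7]; exact h.suffixes

/-- The walk is at the window `(i, j)`, that is, at the buckets `i, …, j - 1`, and registers 25 to 29
hold the data of this window. -/
structure Measured (n : ℤ) (A B : ℤ → ℝ) (b : ℝ) (N : ℤ) (o δ : ℝ) (i j : ℤ) (s : State) :
    Prop where
  left : s.ireg 5 = i
  right : s.ireg 6 = j
  nonneg : 0 ≤ i
  le : i ≤ j
  le_last : j ≤ N + 1
  initial : HasRange (valuesAt n B b fun k => bucket N o δ (A k) < i) (s.rreg 23) (s.rreg 24)
  range : HasRange (outside n A B b N o δ i j) (s.rreg 25) (s.rreg 26)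
  spread : s.rreg 27 = s.rreg 26 - s.rreg 25
  length : s.rreg 28 = (j - i : ℤ) * δ
  cost : s.rreg 29 = max (s.rreg 27) (s.rreg 28)

lemma achieves_walkMeasure {i j : ℤ} (h : Tabulated n A B ε b N o δ s) (hi : s.ireg 5 = i)
    (hj : s.ireg 6 = j) (hi0 : 0 ≤ i) (hij : i ≤ j) (hjN : j ≤ N + 1)
    (hp : HasRange (valuesAt n B b fun k => bucket N o δ (A k) < i) (s.rreg 23) (s.rreg 24)) :
    Achieves walkMeasure s 15 (Measured n A B b N o δ i j) := by
  refine .of_eval rfl (by decide) ⟨?_, ?_, hi0, hij, hjN, ?_, ?_, ?_, ?_, ?_⟩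
  · simp [walkMeasure, seqs, Prog.eval, Instr.exec, hi]
  · simp [walkMeasure, seqs, Prog.eval, Instr.exec, hj]
  · simpa [walkMeasure, seqs, Prog.eval, Instr.exec] using hp
  · simp [walkMeasure, seqs, Prog.eval, Instr.exec, hj]
    exact hp.valuesAt_or (h.suffixes j (by omega) hjN) fun _ => Iff.rfl
  · simp [walkMeasure, seqs, Prog.eval, Instr.exec]
  · simp [walkMeasure, seqs, Prog.eval, Instr.exec, hi, hj, h.mesh]
  · simp [walkMeasure, seqs, Prog.eval, Instr.exec]

lemma achieves_walkRecord {i j : ℤ} (hδ : 0 < δ) (h : OnGrid n A B ε b N o δ s)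
    (hm : Measured n A B b N o δ i j s) (hr : Record n A B s) :
    Achieves walkRecord s 10 fun s' => Measured n A B b N o δ i j s' ∧ Record n A B s' ∧
      s'.rreg 9 ≤ s.rreg 9 ∧ s'.rreg 9 ≤ s'.rreg 29 := by
  refine .cond (T := 9) (fun hlt => .of_eval rfl (by decide) ?_)
    fun hlt => .of_eval rfl (by decide) ?_
  · simp only [Test.Holds] at hlt
    refine ⟨⟨?_, ?_, hm.nonneg, hm.le, hm.le_last, ?_, ?_, ?_, ?_, ?_⟩, ?_, ?_, ?_⟩
    · simpa [seqs, Prog.eval, Instr.exec] using hm.left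
    · simpa [seqs, Prog.eval, Instr.exec] using hm.right
    · simpa [seqs, Prog.eval, Instr.exec] using hm.initial
    · simpa [seqs, Prog.eval, Instr.exec] using hm.range
    · simpa [seqs, Prog.eval, Instr.exec] using hm.spread
    · simpa [seqs, Prog.eval, Instr.exec] using hm.length
    · simpa [seqs, Prog.eval, Instr.exec] using hm.cost
    · have := feasible_of_hasRange_outside hδ hm.nonneg hm.le hm.range
      rw [← hm.length, ← hm.spread, ← hm.cost] at this
      simpa [Record, seqs, Prog.eval, Instr.exec, hm.left, hm.right, h.mesh, h.origin] using this
    · simpa [seqs, Prog.eval, Instr.exec] using hlt.le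
    · simp [seqs, Prog.eval, Instr.exec]
  · exact ⟨hm, hr, le_rfl, not_lt.1 hlt⟩

lemma achieves_walkMove {i j : ℤ} (h : Tabulated n A B ε b N o δ s)
    (hm : Measured n A B b N o δ i j s) :
    Achieves walkMove s 10 fun s' =>
      (s.rreg 28 ≤ s.rreg 27 ∧ s'.ireg 5 = i ∧ s'.ireg 6 = j + 1 ∧
        HasRange (valuesAt n B b fun k => bucket N o δ (A k) < i) (s'.rreg 23) (s'.rreg 24)) ∨
      (s.rreg 27 < s.rreg 28 ∧ s'.ireg 5 = i + 1 ∧ s'.ireg 6 = j ∧ i < j ∧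
        HasRange (valuesAt n B b fun k => bucket N o δ (A k) < i + 1)
          (s'.rreg 23) (s'.rreg 24)) := by
  refine .cond (T := 9) (fun hle => .of_eval rfl (by decide) ?_)
    fun hle => .of_eval rfl (by decide) ?_
  · refine .inl ⟨hle, ?_, ?_, ?_⟩
    · simpa [Prog.eval, Instr.exec] using hm.left
    · simp [Prog.eval, Instr.exec, h.one, hm.right]
    · simpa [Prog.eval, Instr.exec] using hm.initial
  -- An empty window has length zero, so the walk moves its end and `i ≤ j` is preserved.
  · have hij : i < j := by
      refine hm.le.lt_of_ne ?_
      rintro rfl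
      refine hle ?_
      have := hm.range.subset_Icc ((mem_valuesAt b).2 (.inl rfl))
      rw [Test.Holds, hm.length, hm.spread]
      simpa using this.1.trans this.2
    refine .inr ⟨not_le.1 hle, ?_, ?_, hij, ?_⟩
    · simp [seqs, Prog.eval, Instr.exec, h.one, hm.left]
    · simp [seqs, Prog.eval, Instr.exec, hm.right]
    · have := hm.le_last
      have := hm.nonneg
      simp [seqs, Prog.eval, Instr.exec, hm.left]
      exact hm.initial.valuesAt_or (h.cells i (by omega) (by omega)) fun _ => by omega

/-- The windows that are passed when the walk moves on from `(i, j)` are no better than `(i, j)`. -/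
lemma Measured.cost_le {i j i' j' : ℤ} {y₀ y₁ : ℝ} (hδ : 0 < δ)
    (hm : Measured n A B b N o δ i j s)
    (h : s.rreg 28 ≤ s.rreg 27 ∧ j' = j ∧ i ≤ i' ∨ s.rreg 27 < s.rreg 28 ∧ i' = i ∧ j ≤ j')
    (hy : outside n A B b N o δ i' j' ⊆ Set.Icc y₀ y₁) :
    s.rreg 29 ≤ max (y₁ - y₀) ((j' - i' : ℤ) * δ) := by
  rw [hm.cost]
  obtain ⟨hle, rfl, hi⟩ | ⟨hlt, rfl, hj⟩ := h
  · rw [max_eq_left hle, hm.spread]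
    exact le_max_of_le_left (hm.range.width_le ((valuesAt_mono fun k hk => by omega).trans hy))
  · rw [max_eq_right hlt.le, hm.length]
    refine le_max_of_le_right ?_
    gcongr

/-- The invariant of the walk at `(i, j)` says that the best pair is at least as good as any window
`(i', j')` with `i' < i` or `j' < j`. -/
lemma achieves_walk (hδ : 0 < δ) (hN : 0 ≤ N) (h : Tabulated n A B ε b N o δ s)
    (hr : Record n A B s) :
    Achieves walk s (100 * N.toNat + 200) fun s' => Record n A B s' ∧ s'.rreg 9 ≤ s.rreg 9 ∧
      ∀ i j y₀ y₁, 0 ≤ i → i ≤ j → j ≤ N + 1 → outside n A B b N o δ i j ⊆ Set.Icc y₀ y₁ →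
        s'.rreg 9 ≤ max (y₁ - y₀) ((j - i : ℤ) * δ) := by
  refine Achieves.mono (.seq (.instr (.seq (.instr (.seq (.instr (.seq (.instr
    (.seq ((Achieves.loop (T := 35)
    (fun m s' => Record n A B s' ∧ s'.rreg 9 ≤ s.rreg 9 ∧ ∃ i j : ℤ, s'.ireg 5 = i ∧
      s'.ireg 6 = j ∧ 0 ≤ i ∧ i ≤ j ∧ j ≤ N + 2 ∧ i + j + m = 2 * N + 4 ∧
      HasRange (valuesAt n B b fun k => bucket N o δ (A k) < i) (s'.rreg 23) (s'.rreg 24) ∧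
      ∀ i' j' y₀ y₁, 0 ≤ i' → i' ≤ j' → j' ≤ N + 1 → (i' < i ∨ j' < j) →
        outside n A B b N o δ i' j' ⊆ Set.Icc y₀ y₁ →
        s'.rreg 9 ≤ max (y₁ - y₀) ((j' - i' : ℤ) * δ))
      ?_ (2 * N + 4).toNat ?_).mono le_rfl fun s' hs => .skip ?_)))))))))) (by omega) fun _ h => h
  · rintro m s₁ hF hc ⟨hr₁, h9, i, j, hi, hj, hi0, hij, -, hm, hp, hopt⟩
    have hT : Tabulated n A B ε b N o δ s₁ := by
      refine Tabulated.of_frame (P := walkBody) ?_ hF rfl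
      refine h.of_frame (P := seqs [.instr (.iconst 5 0), .instr (.iconst 6 0),
        .instr (.rload 23 4 9), .instr (.rload 24 5 9)]) ?_ rfl
      exact (Runs.seq (.instr _ _) (.seq (.instr _ _) (.seq (.instr _ _)
        (.seq (.instr _ _) (.skip _))))).frame
    simp only [Test.Holds, hj, hT.count_succ] at hc
    refine Achieves.mono (.seq ((achieves_walkMeasure hT hi hj hi0 hij hc hp).frame.mono le_rfl
      fun s₂ h₂ => .seq ((achieves_walkRecord hδ (hT.toOnGrid.of_frame h₂.1 rfl) h₂.2
        ?_).frame.mono le_rfl fun s₃ h₃ => .seq ((achieves_walkMove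
          ((hT.of_frame h₂.1 rfl).of_frame h₃.1 rfl) h₃.2.1).frame.mono le_rfl fun s₄ h₄ =>
            .skip ?_)))) le_rfl fun _ h => h
    · obtain ⟨hF₂, -⟩ := h₂
      rw [Record, hF₂.rreg 5 rfl, hF₂.rreg 6 rfl, hF₂.rreg 7 rfl, hF₂.rreg 8 rfl, hF₂.rreg 9 rfl]
      exact hr₁
    · obtain ⟨hF₂, -⟩ := h₂
      obtain ⟨-, hm₃, hr₃, h9₃, hc₃⟩ := h₃
      obtain ⟨hF₄, h₄⟩ := h₄
      have e9 := hF₄.rreg 9 rfl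
      rw [hF₂.rreg 9 rfl] at h9₃
      have hr₄ : Record n A B s₄ := by
        rw [Record, hF₄.rreg 5 rfl, hF₄.rreg 6 rfl, hF₄.rreg 7 rfl, hF₄.rreg 8 rfl, e9]
        exact hr₃
      have old : ∀ i' j' y₀ y₁, 0 ≤ i' → i' ≤ j' → j' ≤ N + 1 → (i' < i ∨ j' < j) →
          outside n A B b N o δ i' j' ⊆ Set.Icc y₀ y₁ →
          s₄.rreg 9 ≤ max (y₁ - y₀) ((j' - i' : ℤ) * δ) := fun i' j' y₀ y₁ h0 h1 h2 h3 h4 => by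
        rw [e9]; exact h9₃.trans (hopt i' j' y₀ y₁ h0 h1 h2 h3 h4)
      obtain ⟨hle, h5, h6, hp⟩ | ⟨hlt, h5, h6, hij', hp⟩ := h₄
      · refine ⟨m - 1, by omega, hr₄, by linarith, i, j + 1, h5, h6, hi0, by omega, by omega,
          by omega, hp, fun i' j' y₀ y₁ h0 h1 h2 h3 h4 => ?_⟩
        by_cases hnew : i' < i ∨ j' < j
        · exact old i' j' y₀ y₁ h0 h1 h2 hnew h4
        · rw [e9]
          exact hc₃.trans (hm₃.cost_le hδ (.inl ⟨hle, by omega, by omega⟩) h4)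
      · refine ⟨m - 1, by omega, hr₄, by linarith, i + 1, j, h5, h6, by omega, by omega, by omega,
          by omega, hp, fun i' j' y₀ y₁ h0 h1 h2 h3 h4 => ?_⟩
        by_cases hnew : i' < i ∨ j' < j
        · exact old i' j' y₀ y₁ h0 h1 h2 hnew h4
        · rw [e9]
          exact hc₃.trans (hm₃.cost_le hδ (.inr ⟨hlt, by omega, by omega⟩) h4)
  · refine ⟨?_, ?_, 0, 0, ?_, ?_, le_rfl, le_rfl, by omega, by omega, ?_, fun _ _ _ _ _ _ => ?_⟩
    · simpa [Record, Instr.exec] using hr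
    · simp [Instr.exec]
    · simp [Instr.exec]
    · simp [Instr.exec]
    · simp [Instr.exec, h.negOne]
      convert h.cells (-1) le_rfl (by omega) using 4 with k
      have := neg_one_le_bucket N o δ (A k)
      omega
    · omega
  · obtain ⟨hF, hc, m, hr', h9, i, j, hi, hj, hi0, hij, hjN, hm, hp, hopt⟩ := hs
    have f4 : s'.ireg 4 = N + 1 := (hF.ireg 4 rfl).trans (by simp [Instr.exec, h.count_succ])
    simp only [Test.Holds, hj, f4] at hc
    exact ⟨hr', h9, fun i' j' y₀ y₁ h0 h1 h2 h4 => hopt i' j' y₀ y₁ h0 h1 h2 (by omega) h4⟩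

end RealRAM

/-! ### Correctness of the algorithm -/

namespace RealRAM

variable {n : ℤ} {A B : ℤ → ℝ} {ε : ℝ} {s : State}

/-- The program does not change the best pair of slabs. -/
def keepsRecord (P : Prog) : Bool :=
  !P.writes true 5 && !P.writes true 6 && !P.writes true 7 && !P.writes true 8 &&
  !P.writes true 9

lemma Record.of_frame {P : Prog} {s' : State} (h : Record n A B s) (hF : Frame P s s')
    (hP : keepsRecord P = true) : Record n A B s' := by
  simp only [keepsRecord, Bool.and_eq_true, Bool.not_eq_true'] at hP
  obtain ⟨⟨⟨⟨r5, r6⟩, r7⟩, r8⟩, r9⟩ := hP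
  rw [Record, hF.rreg _ r5, hF.rreg _ r6, hF.rreg _ r7, hF.rreg _ r8, hF.rreg _ r9]
  exact h

lemma achieves_refineGrid (hn : 0 ≤ n) (hε : 0 < ε) (h : Ready n A B ε s) (hr : Record n A B s)
    (hW : 0 < s.rreg 17) :
    Achieves refineGrid s (30 * n.toNat + 140 * (⌊8 / ε⌋ + 1).toNat + 310) fun s' =>
      Record n A B s' ∧ s'.rreg 9 ≤ s.rreg 9 ∧ ∀ x₀ x₁ y₀ y₁ w, Feasible n A B x₀ x₁ y₀ y₁ w →
        s.rreg 15 ∈ Set.Icc x₀ x₁ → s.rreg 16 ∈ Set.Icc y₀ y₁ → s.rreg 17 ≤ w →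
        w ≤ 2 * s.rreg 17 → s'.rreg 9 ≤ (1 + ε) * w := by
  refine Achieves.mono (.seq ((achieves_grid h hε hW).frame.mono le_rfl ?_)) (T := 20 +
    (30 * n.toNat + 140 * (⌊8 / ε⌋ + 1).toNat + 290)) (by omega) fun _ h => h
  rintro s₁ ⟨hF₁, N, δ, hG₁, hN, hδ, hNδ, hδε⟩
  rw [← hN]
  have hN0 : 0 ≤ N := by
    have : 0 ≤ ⌊8 / ε⌋ := Int.floor_nonneg.2 (by positivity)
    omega
  refine Achieves.mono (.seq ((achieves_clear hG₁ hN0).frame.mono le_rfl fun s₂ ⟨hF₂, h₂⟩ =>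
    .seq ((achieves_distribute (hG₁.of_frame hF₂ rfl) hn h₂).frame.mono le_rfl
      fun s₃ ⟨hF₃, h₃⟩ => .seq ((achieves_suffixes ((hG₁.of_frame hF₂ rfl).of_frame hF₃ rfl) hN0
        h₃).frame.mono le_rfl fun s₄ ⟨hF₄, h₄⟩ => .seq ((achieves_walk hδ hN0 ⟨((hG₁.of_frame
          hF₂ rfl).of_frame hF₃ rfl).of_frame hF₄ rfl, ?_, h₄⟩
          ((((hr.of_frame hF₁ rfl).of_frame hF₂ rfl).of_frame hF₃ rfl).of_frame hF₄
            rfl)).mono le_rfl fun s₅ ⟨hr₅, h9, h₅⟩ => .skip ⟨hr₅, ?_, ?_⟩))))) (by omega)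
        fun _ h => h
  · rw [hF₄.rarr 4 rfl, hF₄.rarr 5 rfl]
    exact h₃
  · rwa [hF₄.rreg 9 rfl, hF₃.rreg 9 rfl, hF₂.rreg 9 rfl, hF₁.rreg 9 rfl] at h9
  · intro x₀ x₁ y₀ y₁ w hf ha hb hWw hw
    obtain ⟨i, j, hi, hij, hj, hout, hlen⟩ := hf.exists_window ha hb hw hδ hNδ
    refine (h₅ i j y₀ y₁ hi hij hj hout).trans (max_le ?_ ?_)
    · have := hf.right_width
      nlinarith
    · nlinarith

lemma achieves_improve (hn : 0 < n) (hε : 0 < ε) (h : Ready n A B ε s) (hr : Record n A B s)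
    {z₁ z₂ : ℤ} (h11 : s.rreg 11 = z₁) (h12 : s.rreg 12 = z₂) :
    Achieves improve s (80 * n.toNat + 140 * (⌊8 / ε⌋ + 1).toNat + 400) fun s' =>
      Record n A B s' ∧ s'.rreg 9 ≤ s.rreg 9 ∧ AnchoredBound n A B (1 + ε) (s'.rreg 9) z₁ z₂ := by
  refine Achieves.mono (.seq ((achieves_anchors h hn).frame.mono le_rfl
    fun s₁ ⟨hF₁, q, r, hq, hr', e15, e16, hqr⟩ => .seq ((achieves_radius (h.of_frame hF₁ rfl)
      hn).frame.mono le_rfl fun s₂ ⟨hF₂, hW0, hW, hWle⟩ => .seq ((achieves_crude (n := n) (A := A)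
        (B := B) ((hr.of_frame hF₁ rfl).of_frame hF₂ rfl) hW0 ?_).frame.mono le_rfl
        fun s₃ ⟨hF₃, hr₃, h9₃, h9W⟩ => .seq (Achieves.cond
          (T := 30 * n.toNat + 140 * (⌊8 / ε⌋ + 1).toNat + 310)
          (Q := fun s' => Achieves .skip s' 0 fun s' => Record n A B s' ∧ s'.rreg 9 ≤ s.rreg 9 ∧
            AnchoredBound n A B (1 + ε) (s'.rreg 9) z₁ z₂) (fun hpos => ?_) fun hpos => ?_)))))
    (by omega) fun _ h => h
  · rw [hF₂.rreg 15 rfl, hF₂.rreg 16 rfl]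
    exact hW
  all_goals
    have h₃ : Ready n A B ε s₃ := ((h.of_frame hF₁ rfl).of_frame hF₂ rfl).of_frame hF₃ rfl
    have e15₃ : s₃.rreg 15 = A q := by rw [hF₃.rreg 15 rfl, hF₂.rreg 15 rfl, e15]
    have e16₃ : s₃.rreg 16 = B r := by rw [hF₃.rreg 16 rfl, hF₂.rreg 16 rfl, e16]
    have e17 := hF₃.rreg 17 rfl
    rw [hF₂.rreg 9 rfl, hF₁.rreg 9 rfl] at h9₃
    rw [h11, h12] at hqr
    have hWw : ∀ x₀ x₁ y₀ y₁ w, Feasible n A B x₀ x₁ y₀ y₁ w → A q ∈ Set.Icc x₀ x₁ →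
        B r ∈ Set.Icc y₀ y₁ → s₃.rreg 17 ≤ w := by
      intro x₀ x₁ y₀ y₁ w hf ha hb
      have hx := hf.left_width
      have hy := hf.right_width
      rw [e17]
      refine hWle w (by linarith [hf.left_le]) fun k h0 h1 => (hf.covers k h0 h1).imp ?_ ?_
      · rintro ⟨l, u⟩; rw [e15, abs_le]; constructor <;> linarith [ha.1, ha.2]
      · rintro ⟨l, u⟩; rw [e16, abs_le]; constructor <;> linarith [hb.1, hb.2]
  · rw [Test.Holds, h₃.rzero] at hpos
    refine (achieves_refineGrid hn.le hε h₃ hr₃ hpos).mono le_rfl fun s₄ ⟨hr₄, h9, h₄⟩ =>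
      .skip ⟨hr₄, h9.trans h9₃, q, r, hqr, hq, hr', fun x₀ x₁ y₀ y₁ w hf ha hb => ?_⟩
    have hWw' := hWw x₀ x₁ y₀ y₁ w hf ha hb
    -- If `2 W ≤ w`, then the pair recorded by `crude` is already good enough.
    rcases le_total w (2 * s₃.rreg 17) with hw | hw
    · exact h₄ x₀ x₁ y₀ y₁ w hf (e15₃ ▸ ha) (e16₃ ▸ hb) hWw' hw
    · rw [← e17] at h9W
      nlinarith
  -- If `W = 0`, then `crude` has recorded two lines.
  · rw [Test.Holds, h₃.rzero, not_lt] at hpos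
    refine .of_eval rfl (Nat.zero_le _) (.skip ⟨hr₃, h9₃, q, r, hqr, hq, hr',
      fun x₀ x₁ y₀ y₁ w hf ha hb => ?_⟩)
    have hw : 0 ≤ w := by linarith [hf.left_le, hf.left_width]
    rw [← e17] at h9W
    exact h9W.trans (by nlinarith)

lemma achieves_improveWith (hn : 0 < n) (hε : 0 < ε) (h : Ready n A B ε s) (hr : Record n A B s)
    (z₁ z₂ : ℤ) :
    Achieves (improveWith z₁ z₂) s (80 * n.toNat + 140 * (⌊8 / ε⌋ + 1).toNat + 410) fun s' =>
      Ready n A B ε s' ∧ Record n A B s' ∧ s'.rreg 9 ≤ s.rreg 9 ∧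
        AnchoredBound n A B (1 + ε) (s'.rreg 9) z₁ z₂ := by
  have hs : Frame (improveWith z₁ z₂) s ((((s.setI 7 z₁).setR 11 z₁).setI 7 z₂).setR 12 z₂) := by
    constructor <;> intro r hr <;>
      simp [improveWith, seqs, Prog.writes, Instr.writes] at hr ⊢ <;> simp [hr]
  refine Achieves.mono (.frame (.seq (.instr (.seq (.instr (.seq (.instr (.seq (.instr (.seq
    ((achieves_improve hn hε (s := (((s.setI 7 z₁).setR 11 z₁).setI 7 z₂).setR 12 z₂)
      (h.of_frame hs rfl) ?_ (z₁ := z₁) (z₂ := z₂) ?_ ?_).mono le_rfl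
        fun s' hs' => .skip hs'))))))))))) (by omega)
    fun s' ⟨hF, h'⟩ => ⟨h.of_frame hF rfl, h'⟩
  · simpa [Record] using hr
  · simp
  · simp

lemma achieves_twoSlabs {s : State} (hn : 0 < s.ireg 0) (hε : 0 < s.rreg 0)
    (hi : ∀ r, r ≠ 0 → s.ireg r = 0) (hr : ∀ r, 5 ≤ r → s.rreg r = 0) :
    Achieves twoSlabs s (340 * (s.ireg 0).toNat + 560 * (⌊8 / s.rreg 0⌋ + 1).toNat + 1700)
      fun s' => ∃ (A B : ℤ → ℝ) (v : ℝ),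
        (∀ k, 0 ≤ k → k < s.ireg 0 →
          A k = s.rreg 1 * s.rarr 1 k - s.rreg 2 * s.rarr 0 k ∧
          B k = s.rreg 3 * s.rarr 1 k - s.rreg 4 * s.rarr 0 k) ∧
        Feasible (s.ireg 0) A B (s'.rreg 0) (s'.rreg 1) (s'.rreg 2) (s'.rreg 3) v ∧
        ∀ x₀ x₁ y₀ y₁ w, Feasible (s.ireg 0) A B x₀ x₁ y₀ y₁ w → v ≤ (1 + s.rreg 0) * w := by
  refine Achieves.mono (.seq ((achieves_projections hn.le hi hr).mono le_rfl
    fun s₀ ⟨A, B, h₀, hr₀, hAB⟩ =>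
    .seq ((achieves_improveWith hn hε h₀ hr₀ 1 1).mono le_rfl fun s₁ ⟨h₁, hr₁, _, b₁⟩ =>
    .seq ((achieves_improveWith hn hε h₁ hr₁ 1 (-1)).mono le_rfl fun s₂ ⟨h₂, hr₂, l₂, b₂⟩ =>
    .seq ((achieves_improveWith hn hε h₂ hr₂ (-1) 1).mono le_rfl fun s₃ ⟨h₃, hr₃, l₃, b₃⟩ =>
    .seq ((achieves_improveWith hn hε h₃ hr₃ (-1) (-1)).mono le_rfl fun s₄ ⟨_, hr₄, l₄, b₄⟩ =>
    .of_eval (T := 4) rfl (by decide) ⟨A, B, s₄.rreg 9, hAB, ?_, fun x₀ x₁ y₀ y₁ w hf =>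
      hf.le_of_anchoredBound ?_⟩))))))
    (by omega) fun _ h => h
  · simpa [Record, seqs, Prog.eval, Instr.exec] using hr₄
  · rintro _ _ (rfl | rfl) (rfl | rfl)
    · exact b₁.mono (by linarith)
    · exact b₂.mono (by linarith)
    · exact b₃.mono (by linarith)
    · exact b₄

end RealRAM

/-! ### Optimal pairs of slabs -/

/-- A slab can be shrunk to one bounded by lines through the given points, without losing any of
these points. -/
lemma exists_tight_interval {n : ℕ} (hn : 0 < n) (a : Fin n → ℝ) {lo hi : ℝ} (h : lo ≤ hi) :
    ∃ l u, a l ≤ a u ∧ a u - a l ≤ hi - lo ∧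
      ∀ m, a m ∈ Set.Icc lo hi → a m ∈ Set.Icc (a l) (a u) := by
  classical
  by_cases hne : (Finset.univ.filter fun m => a m ∈ Set.Icc lo hi).Nonempty
  · obtain ⟨l, hl, hl'⟩ := Finset.exists_min_image _ a hne
    obtain ⟨u, hu, hu'⟩ := Finset.exists_max_image _ a hne
    simp only [Finset.mem_filter, Finset.mem_univ, true_and] at hl hl' hu hu'
    exact ⟨l, u, hl' u hu, by linarith [hl.1, hu.2], fun m hm => ⟨hl' m hm, hu' m hm⟩⟩
  · rw [Finset.not_nonempty_iff_eq_empty, Finset.filter_eq_empty_iff] at hne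
    exact ⟨⟨0, hn⟩, ⟨0, hn⟩, le_rfl, by simpa, fun m hm => absurd hm (hne (Finset.mem_univ m))⟩

lemma isCoveringPair_range_iff {n : ℕ} {p : Fin n → Plane} {θ₁ θ₂ : ℝ} {σ₁ σ₂ : Slab} :
    IsCoveringPair θ₁ θ₂ (Set.range p) σ₁ σ₂ ↔
      σ₁.orientation = θ₁ ∧ σ₂.orientation = θ₂ ∧
        ∀ k, inner ℝ (unitNormal θ₁) (p k) ∈ Set.Icc σ₁.lo σ₁.hi ∨
          inner ℝ (unitNormal θ₂) (p k) ∈ Set.Icc σ₂.lo σ₂.hi := by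
  unfold IsCoveringPair
  refine and_congr_right fun h₁ => and_congr_right fun h₂ => ?_
  rw [Set.range_subset_iff, ← h₁, ← h₂]
  rfl

/-- The minimum width is attained, since only slabs bounded by lines through the given points
matter, and there are finitely many of these. -/
lemma exists_isOptimalWidth {n : ℕ} (hn : 0 < n) (p : Fin n → Plane) {θ₁ θ₂ : ℝ}
    (hθ₁ : θ₁ ∈ Set.Ico 0 Real.pi) (hθ₂ : θ₂ ∈ Set.Ico 0 Real.pi) :
    ∃ w, IsOptimalWidth θ₁ θ₂ (Set.range p) w := by
  set a : Fin n → ℝ := fun k => inner ℝ (unitNormal θ₁) (p k)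
  set b : Fin n → ℝ := fun k => inner ℝ (unitNormal θ₂) (p k)
  set V := {v | ∃ σ₁ σ₂ : Slab, IsCoveringPair θ₁ θ₂ (Set.range p) σ₁ σ₂ ∧
    v = max σ₁.width σ₂.width}
  set F : Set ℝ := Set.range fun x : (Fin n × Fin n) × Fin n × Fin n =>
    max (a x.1.2 - a x.1.1) (b x.2.2 - b x.2.1)
  have hVF : ∀ v ∈ V, ∃ v' ∈ V ∩ F, v' ≤ v := by
    rintro _ ⟨σ₁, σ₂, hσ, rfl⟩
    obtain ⟨-, -, hc⟩ := isCoveringPair_range_iff.1 hσ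
    obtain ⟨l, u, hlu, hw, hm⟩ := exists_tight_interval hn a σ₁.lo_le_hi
    obtain ⟨l', u', hlu', hw', hm'⟩ := exists_tight_interval hn b σ₂.lo_le_hi
    refine ⟨_, ⟨⟨⟨θ₁, a l, a u, hθ₁, hlu⟩, ⟨θ₂, b l', b u', hθ₂, hlu'⟩,
      isCoveringPair_range_iff.2 ⟨rfl, rfl, fun k => (hc k).imp (hm k) (hm' k)⟩, rfl⟩,
      ((l, u), (l', u')), rfl⟩, max_le_max hw hw'⟩
  have hne : (V ∩ F).Nonempty := by
    obtain ⟨l, hl⟩ := (Set.finite_range a).bddBelow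
    obtain ⟨u, hu⟩ := (Set.finite_range a).bddAbove
    have hlu : l ≤ u := (hl ⟨⟨0, hn⟩, rfl⟩).trans (hu ⟨⟨0, hn⟩, rfl⟩)
    obtain ⟨v, hv, -⟩ := hVF _ ⟨⟨θ₁, l, u, hθ₁, hlu⟩, ⟨θ₂, 0, 0, hθ₂, le_rfl⟩,
      isCoveringPair_range_iff.2 ⟨rfl, rfl, fun k => .inl ⟨hl ⟨k, rfl⟩, hu ⟨k, rfl⟩⟩⟩, rfl⟩
    exact ⟨v, hv⟩
  obtain ⟨w, hw, hmin⟩ := Set.exists_min_image (V ∩ F) id ((Set.finite_range _).inter_of_right _)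
    hne
  refine ⟨w, hw.1, fun v hv => ?_⟩
  obtain ⟨v', hv', hle⟩ := hVF v hv
  exact (hmin v' hv').trans hle

lemma inner_unitNormal (θ : ℝ) (q : Plane) :
    inner ℝ (unitNormal θ) q = Real.cos θ * q 1 - Real.sin θ * q 0 := by
  simp [unitNormal, PiLp.inner_apply, Fin.sum_univ_two]
  ring

theorem mainTheorem5 :
    ∃ (P : RealRAM.Prog) (C : ℝ),
      ∀ (n : ℕ), 0 < n → ∀ (p : Fin n → Plane) (θ₁ θ₂ : ℝ),
        θ₁ ∈ Set.Ico 0 Real.pi → θ₂ ∈ Set.Ico 0 Real.pi → ∀ (ε : ℝ), 0 < ε →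
          ∃ (s : RealRAM.State) (t : ℕ) (σ₁ σ₂ : Slab) (wStar : ℝ),
            RealRAM.Runs P (RealRAM.input p θ₁ θ₂ ε) s t ∧
            (t : ℝ) ≤ C * (n + 1 / ε) ∧
            RealRAM.Reports s σ₁ σ₂ ∧
            IsCoveringPair θ₁ θ₂ (Set.range p) σ₁ σ₂ ∧
            IsOptimalWidth θ₁ θ₂ (Set.range p) wStar ∧
            max σ₁.width σ₂.width ≤ (1 + ε) * wStar := by
  refine ⟨RealRAM.twoSlabs, 5000, fun n hn p θ₁ θ₂ hθ₁ hθ₂ ε hε => ?_⟩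
  obtain ⟨s, t, hrun, ht, A, B, v, hAB, hf, hopt⟩ := RealRAM.achieves_twoSlabs
    (s := RealRAM.input p θ₁ θ₂ ε) (by simpa [RealRAM.input] using hn)
    (by simpa [RealRAM.input] using hε) (fun r hr => by simp [RealRAM.input, hr])
    (fun r hr => by
      obtain ⟨r, rfl⟩ := Nat.exists_eq_add_of_le' hr
      rfl)
  have hn' : (RealRAM.input p θ₁ θ₂ ε).ireg 0 = n := rfl
  have hε' : (RealRAM.input p θ₁ θ₂ ε).rreg 0 = ε := rfl
  rw [hn', hε'] at ht
  rw [hn'] at hAB hf hopt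
  rw [hε'] at hopt
  have hA : ∀ k : Fin n, A k = inner ℝ (unitNormal θ₁) (p k) ∧
      B k = inner ℝ (unitNormal θ₂) (p k) := fun k => by
    have := hAB k (by omega) (by omega)
    simpa [RealRAM.input, inner_unitNormal] using this
  obtain ⟨w, hw⟩ := exists_isOptimalWidth hn p hθ₁ hθ₂
  refine ⟨s, t, ⟨θ₁, s.rreg 0, s.rreg 1, hθ₁, hf.left_le⟩, ⟨θ₂, s.rreg 2, s.rreg 3, hθ₂,
    hf.right_le⟩, w, hrun, ?_, ⟨rfl, rfl, rfl, rfl⟩, isCoveringPair_range_iff.2 ⟨rfl, rfl,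
      fun k => ?_⟩, hw, (max_le hf.left_width hf.right_width).trans ?_⟩
  · have h8 : 0 ≤ ⌊8 / ε⌋ := Int.floor_nonneg.2 (by positivity)
    have hfl : ((⌊8 / ε⌋ + 1).toNat : ℝ) ≤ 8 * (1 / ε) + 1 := by
      have h : ((⌊8 / ε⌋ + 1).toNat : ℤ) = ⌊8 / ε⌋ + 1 := Int.toNat_of_nonneg (by omega)
      have h' : ((⌊8 / ε⌋ + 1).toNat : ℝ) = ⌊8 / ε⌋ + 1 := by exact_mod_cast h
      rw [h', mul_one_div]
      linarith [Int.floor_le (8 / ε)]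
    have hn1 : (1 : ℝ) ≤ n := by exact_mod_cast hn
    have hε1 : 0 < 1 / ε := by positivity
    rw [Int.toNat_natCast] at ht
    have ht' : (t : ℝ) ≤ 340 * n + 560 * ((⌊8 / ε⌋ + 1).toNat : ℝ) + 1700 := by exact_mod_cast ht
    linarith
  · rw [← (hA k).1, ← (hA k).2]
    exact hf.covers k (by omega) (by omega)
  · obtain ⟨⟨σ₁, σ₂, hσ, rfl⟩, -⟩ := hw
    obtain ⟨-, -, hc⟩ := isCoveringPair_range_iff.1 hσ
    refine hopt σ₁.lo σ₁.hi σ₂.lo σ₂.hi _ ⟨σ₁.lo_le_hi, σ₂.lo_le_hi, le_max_left _ _,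
      le_max_right _ _, fun k h0 h1 => ?_⟩
    lift k to ℕ using h0
    have := hc ⟨k, by omega⟩
    rwa [← (hA _).1, ← (hA _).2] at this
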